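/- **Setting.** Fix $x_0<0$ and $0<\underline k<\overline k$; constants below may depend on $x_0$. *Exact data.* Let $c^*\in C^2(\mathbb R)$ be real valued with $c^*\ge 1$ and $c^*=1$ outside $(0,1)$. For each $k>0$ let $u^*(\cdot,k)$ solve $u''+k^2c^*u=-\delta(x-x_0)$ on $\mathbb R$ with $u'+iku\to0$ as $x\to+\infty$ and $u'-iku\to0$ as $x\to-\infty$. Put $u_0(x,k)=e^{-ik|x-x_0|}/(2ik)$, $w^*=u^*/u_0$, $g_0^*(k)=w^*(0,k)$. For $x\in[0,1]$, $\log w^*(x,k)$ is the logarithm of $w^*(x,k)$ that is continuous in $k>0$ and satisfies $$\log w^*(x,k)+\tfrac14\ln c^*(x)+ik\Bigl(\int_{x_0}^x\sqrt{c^*(\xi)}\,d\xi-x+x_0\Bigr)\to0\quad(k\to\infty);$$ $\log g_0^*(k)=\log w^*(0,k)$. The function $r^*$ on $[0,1]$ is defined by $V^*(x):=\overline k^{-2}\log w^*(x,\overline k)=r^*(x)/\overline k$. *Noisy data.* Let $\delta>0$ and let $g_0$ on $[\underline k,\overline k]$ have a $C^1$ logarithm $\log g_0$, with $$|\log g_0-\log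 g_0^*|\le\delta,\qquad |g_0-g_0^*|\le\delta,\qquad |g_0'-(g_0^*)'|\le\delta\quad\text{on }[\underline k,\overline k].$$ Put $p_0=\partial_k\bigl(\log g_0/k^2\bigr)$, $p_1=\partial_k\bigl[\tfrac{2i}{k}\bigl(1-\tfrac1{g_0}\bigr)\bigr]$, and $m(x,k)=(x^2-1)^2p_0(k)+x(x^2-1)^2p_1(k)$. *Tail function.* Let $V$ minimize $\tfrac12\bigl(\|V''\|^2_{L^2(0,1)}+\delta^2\|V\|^2_{H^3(0,1)}\bigr)$ among the complex valued $V\in H^3(0,1)$ with $V(0)=\log g_0(\overline k)/\overline k^2$, $V'(0)=\frac i{\overline k}\bigl(1-\frac1{g_0(\overline k)}\bigr)$, $V'(1)=0$. *Functional.* Let $H$ be the real Hilbert space of complex valued functions $p\in L^2\bigl((\underline k,\overline k);H^2(0,1)\bigr)$ with $p(0,k)=p'(0,k)=p'(1,k)=0$ (a prime on a function of $x$ and $k$ is $\partial_x$) and norm $\|p\|_H^2=\int_{\underline k}^{\overline k}\|p(\cdot,k)\|_{H^2(0,1)}^2dk$. With $Q=p+m$ and $v_x(x,k)=-\int_k^{\overline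 k}Q'(x,\tau)\,d\tau+V'(x)$ put $$L(p)=Q''-2ikQ'+2k^2Q'v_x-2iv_x+2kv_x^2,\qquad J_\lambda(p)=e^{2\lambda}\int_{\underline k}^{\overline k}\int_0^1|L(p)|^2e^{-2\lambda x}\,dx\,dk .$$ For $R>0$ let $\overline B(R)\subset H$ be the closed ball of radius $R$ about $0$ and $Q_{\overline B}:H\to\overline B(R)$ the projection on it. Let $J_\lambda'(p)\in H$ denote the gradient of $J_\lambda$. **Theorem 5.3.** There is $\delta_0>0$, depending only on $r^*,\underline k,\overline k$, such that for all $R>0$ there is $\lambda_0>1$, depending only on $r^*,\underline k,\overline k,R$ and an upper bound for $\|p_1\|_{C[\underline k,\overline k]}$, such that for all $\lambda\ge\lambda_0$ there are $\gamma_0\in(0,1)$ and $q:(0,\gamma_0)\to(0,1)$, depending only on these quantities, on $\lambda$ and on an upper bound for $\|p_0\|_{C[\underline k,\overline k]}$, with the following property whenever $0<\delta\le\delta_0$. The functional $J_\lambda$ is Fréchet differentiable on $H$ and has a unique minimizer $p_{\min,\lambda}$ on $\overline B(R)$. For every $\gamma\in(0,\gamma_0)$ and every $p^{(0)}\in\overline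 B(R)$ the sequence $$p^{(n+1)}=Q_{\overline B}\bigl(p^{(n)}-\gamma J_\lambda'(p^{(n)})\bigr),\qquad n=0,1,\dots$$ converges in $H$ to $p_{\min,\lambda}$, and $$\|p^{(n)}-p_{\min,\lambda}\|_H\le q(\gamma)^n\,\|p^{(0)}-p_{\min,\lambda}\|_H,\qquad n=1,2,\dots$$ -/

import Mathlib

open MeasureTheory Set Filter Topology
open scoped ENNReal

noncomputable section

namespace HelmholtzCIP

/-! ### Sobolev functions on the unit interval -/

/-- `F` is absolutely continuous on `[0,1]` and `f` is its derivative. -/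
def IsPrimitive (F f : ℝ → ℂ) : Prop :=
  IntervalIntegrable f volume 0 1 ∧
    ∀ x ∈ Icc (0 : ℝ) 1, F x = F 0 + ∫ s in (0 : ℝ)..x, f s

/-- Lebesgue measure on the unit interval. -/
abbrev μ01 : Measure ℝ := volume.restrict (Ioo (0 : ℝ) 1)

/-- Complex valued `L²(0,1)`, regarded below as a real Hilbert space (pairs of real functions). -/
abbrev L2 : Type := Lp ℂ 2 μ01

/-- Triples of `L²(0,1)` functions with norm `(‖f₀‖² + ‖f₁‖² + ‖f₂‖²)^{1/2}`. -/
abbrev L2Triple : Type := PiLp 2 (fun _ : Fin 3 => L2)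

lemma L2.intervalIntegrable (f : L2) {a b : ℝ} (ha : a ∈ Icc (0 : ℝ) 1) (hb : b ∈ Icc (0 : ℝ) 1) :
    IntervalIntegrable f volume a b := by
  have h1 : IntegrableOn f (Ioo (0 : ℝ) 1) volume :=
    (Lp.memLp f).integrable (by norm_num)
  rw [intervalIntegrable_iff]
  rw [← integrableOn_Icc_iff_integrableOn_Ioo] at h1
  refine h1.mono_set (fun x hx => ?_)
  rw [uIoc, mem_Ioc] at hx
  exact ⟨(le_min ha.1 hb.1).trans hx.1.le, hx.2.trans (max_le ha.2 hb.2)⟩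

lemma L2.integral_norm_le (f : L2) {x : ℝ} (hx : x ∈ Icc (0 : ℝ) 1) :
    ‖∫ s in (0 : ℝ)..x, f s‖ ≤ ‖f‖ := by
  have hprob : IsProbabilityMeasure μ01 := ⟨by simp⟩
  have h1 : Integrable f μ01 := (Lp.memLp f).integrable (by norm_num)
  calc ‖∫ s in (0 : ℝ)..x, f s‖ ≤ ∫ s in (0 : ℝ)..x, ‖f s‖ :=
        intervalIntegral.norm_integral_le_integral_norm hx.1
    _ ≤ ∫ s in (0 : ℝ)..1, ‖f s‖ := by
        apply intervalIntegral.integral_mono_interval le_rfl hx.1 hx.2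
        · exact Eventually.of_forall fun s => norm_nonneg _
        · exact (L2.intervalIntegrable f ⟨le_rfl, zero_le_one⟩ ⟨zero_le_one, le_rfl⟩).norm
    _ = ∫ s, ‖f s‖ ∂μ01 := by
        rw [intervalIntegral.integral_of_le zero_le_one, integral_Ioc_eq_integral_Ioo]
    _ = (eLpNorm f 1 μ01).toReal := by
        rw [eLpNorm_one_eq_lintegral_enorm, integral_norm_eq_lintegral_enorm h1.1]
    _ ≤ (eLpNorm f 2 μ01).toReal := by
        apply ENNReal.toReal_mono (Lp.memLp f).2.ne
        exact eLpNorm_le_eLpNorm_of_exponent_le (by norm_num) h1.1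
    _ = ‖f‖ := (Lp.norm_def f).symm

lemma L2.continuousOn_integral (f : L2) :
    ContinuousOn (fun x => ∫ s in (0 : ℝ)..x, f s) (Icc 0 1) := by
  have h := intervalIntegral.continuousOn_primitive_interval (μ := volume) (f := f) (a := 0) (b := 1)
    (by
      have := (L2.intervalIntegrable f (a := 0) (b := 1) ⟨le_rfl, zero_le_one⟩ ⟨zero_le_one, le_rfl⟩)
      rw [intervalIntegrable_iff_integrableOn_Icc_of_le zero_le_one] at this
      rwa [uIcc_of_le zero_le_one])
  rwa [uIcc_of_le zero_le_one] at h

lemma L2.memLp_integral (f : L2) : MemLp (fun x => ∫ s in (0 : ℝ)..x, f s) 2 μ01 := by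
  refine MemLp.of_bound (C := ‖f‖) ?_ ?_
  · exact ((L2.continuousOn_integral f).mono Ioo_subset_Icc_self).aestronglyMeasurable
      measurableSet_Ioo
  · filter_upwards [ae_restrict_mem measurableSet_Ioo] with x hx
    exact L2.integral_norm_le f ⟨hx.1.le, hx.2.le⟩

/-- The integration operator `f ↦ ∫₀ˣ f` on `L²(0,1)`. -/
def L2.volterra : L2 →L[ℝ] L2 :=
  LinearMap.mkContinuous
    { toFun := fun f => (L2.memLp_integral f).toLp _
      map_add' := by
        intro f g
        rw [← MemLp.toLp_add]
        apply MemLp.toLp_congr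
        have hfg := Lp.coeFn_add f g
        filter_upwards [ae_restrict_mem measurableSet_Ioo] with x hx
        have hx' : x ∈ Icc (0 : ℝ) 1 := ⟨hx.1.le, hx.2.le⟩
        have h0 : (0 : ℝ) ∈ Icc (0 : ℝ) 1 := ⟨le_rfl, zero_le_one⟩
        simp only [Pi.add_apply]
        rw [← intervalIntegral.integral_add (L2.intervalIntegrable f h0 hx')
          (L2.intervalIntegrable g h0 hx')]
        rw [intervalIntegral.integral_of_le hx.1.le, intervalIntegral.integral_of_le hx.1.le]
        apply integral_congr_ae
        have : volume.restrict (Ioc 0 x) ≤ μ01 :=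
          Measure.restrict_mono
            (show Ioc 0 x ⊆ Ioo (0 : ℝ) 1 from fun y hy => ⟨hy.1, hy.2.trans_lt hx.2⟩) le_rfl
        filter_upwards [hfg.filter_mono (ae_mono this)] with y hy
        simpa using hy
      map_smul' := by
        intro a f
        rw [RingHom.id_apply, ← MemLp.toLp_const_smul]
        apply MemLp.toLp_congr
        have hfg := Lp.coeFn_smul a f
        filter_upwards [ae_restrict_mem measurableSet_Ioo] with x hx
        simp only [Pi.smul_apply]
        rw [← intervalIntegral.integral_smul]
        rw [intervalIntegral.integral_of_le hx.1.le, intervalIntegral.integral_of_le hx.1.le]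
        apply integral_congr_ae
        have : volume.restrict (Ioc 0 x) ≤ μ01 :=
          Measure.restrict_mono
            (show Ioc 0 x ⊆ Ioo (0 : ℝ) 1 from fun y hy => ⟨hy.1, hy.2.trans_lt hx.2⟩) le_rfl
        filter_upwards [hfg.filter_mono (ae_mono this)] with y hy
        simpa using hy }
    1 (by
      intro f
      have hprob : IsProbabilityMeasure μ01 := ⟨by simp⟩
      rw [one_mul]
      refine (Lp.norm_le_of_ae_bound (norm_nonneg f) ?_).trans (by simp [measureUnivNNReal])
      filter_upwards [(L2.memLp_integral f).coeFn_toLp, ae_restrict_mem measurableSet_Ioo]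
        with x h hx
      have : ((L2.memLp_integral f).toLp _ : ℝ → ℂ) x = ∫ s in (0 : ℝ)..x, f s := h
      change ‖((L2.memLp_integral f).toLp _ : ℝ → ℂ) x‖ ≤ _
      rw [this]
      exact L2.integral_norm_le f ⟨hx.1.le, hx.2.le⟩)

lemma L2.volterra_coe (f : L2) : L2.volterra f =ᵐ[μ01] fun x => ∫ s in (0 : ℝ)..x, f s :=
  (L2.memLp_integral f).coeFn_toLp

/-- A triple `(f, f', f'')` in `L²(0,1)³` belongs to a function of class `H²(0,1)` with
`f(0) = f'(0) = f'(1) = 0`: `f` and `f'` have absolutely continuous representatives `F`, `F₁`,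
whose derivatives are `f'` and `f''`, and which satisfy the boundary conditions. -/
def IsH2Zero (t : L2Triple) : Prop :=
  ∃ F F₁ : ℝ → ℂ, t 0 =ᵐ[μ01] F ∧ t 1 =ᵐ[μ01] F₁ ∧
    IsPrimitive F F₁ ∧ IsPrimitive F₁ (t 2) ∧ F 0 = 0 ∧ F₁ 0 = 0 ∧ F₁ 1 = 0

lemma isH2Zero_iff (t : L2Triple) :
    IsH2Zero t ↔ t 0 = L2.volterra (t 1) ∧ t 1 = L2.volterra (t 2) ∧
      ∫ s in (0 : ℝ)..1, t 2 s = 0 := by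
  have h0 : (0 : ℝ) ∈ Icc (0 : ℝ) 1 := ⟨le_rfl, zero_le_one⟩
  have h1 : (1 : ℝ) ∈ Icc (0 : ℝ) 1 := ⟨zero_le_one, le_rfl⟩
  have key : ∀ (f g : ℝ → ℂ), f =ᵐ[μ01] g → ∀ x ∈ Icc (0 : ℝ) 1,
      ∫ s in (0 : ℝ)..x, f s = ∫ s in (0 : ℝ)..x, g s := by
    intro f g hfg x hx
    rw [intervalIntegral.integral_of_le hx.1, intervalIntegral.integral_of_le hx.1,
      integral_Ioc_eq_integral_Ioo, integral_Ioc_eq_integral_Ioo]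
    apply integral_congr_ae
    exact hfg.filter_mono (ae_mono (Measure.restrict_mono (Ioo_subset_Ioo le_rfl hx.2) le_rfl))
  constructor
  · rintro ⟨F, F₁, hF, hF₁, hp, hp₁, a, b, c⟩
    refine ⟨?_, ?_, ?_⟩
    · apply Lp.ext
      filter_upwards [hF, L2.volterra_coe (t 1), ae_restrict_mem measurableSet_Ioo] with x h h' hx
      have hx' : x ∈ Icc (0 : ℝ) 1 := ⟨hx.1.le, hx.2.le⟩
      rw [h, h', hp.2 x hx', a, zero_add, key _ _ hF₁ x hx']
    · apply Lp.ext
      filter_upwards [hF₁, L2.volterra_coe (t 2), ae_restrict_mem measurableSet_Ioo] with x h h' hx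
      have hx' : x ∈ Icc (0 : ℝ) 1 := ⟨hx.1.le, hx.2.le⟩
      rw [h, h', hp₁.2 x hx', b, zero_add]
    · have := hp₁.2 1 h1
      rw [b, c, zero_add] at this
      exact this.symm
  · rintro ⟨a, b, c⟩
    have hb : t 1 =ᵐ[μ01] fun x => ∫ s in (0 : ℝ)..x, t 2 s := by
      have := L2.volterra_coe (t 2)
      rwa [← b] at this
    have ha : t 0 =ᵐ[μ01] fun x => ∫ s in (0 : ℝ)..x, t 1 s := by
      have := L2.volterra_coe (t 1)
      rwa [← a] at this
    refine ⟨fun x => ∫ s in (0 : ℝ)..x, t 1 s, fun x => ∫ s in (0 : ℝ)..x, t 2 s, ha, hb,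
      ⟨?_, ?_⟩, ⟨L2.intervalIntegrable _ h0 h1, ?_⟩, by simp, by simp, c⟩
    · apply ContinuousOn.intervalIntegrable
      rw [uIcc_of_le zero_le_one]
      exact L2.continuousOn_integral (t 2)
    · intro x hx
      simp only [intervalIntegral.integral_same, zero_add]
      exact key _ _ hb x hx
    · intro x hx
      simp

lemma L2.continuous_integral : Continuous fun f : L2 => ∫ s in (0 : ℝ)..1, f s := by
  have h0 : (0 : ℝ) ∈ Icc (0 : ℝ) 1 := ⟨le_rfl, zero_le_one⟩
  have h1 : (1 : ℝ) ∈ Icc (0 : ℝ) 1 := ⟨zero_le_one, le_rfl⟩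
  refine LipschitzWith.continuous (K := 1) (LipschitzWith.of_dist_le_mul fun f g => ?_)
  rw [dist_eq_norm, dist_eq_norm, NNReal.coe_one, one_mul,
    ← intervalIntegral.integral_sub (L2.intervalIntegrable f h0 h1) (L2.intervalIntegrable g h0 h1)]
  refine le_trans (le_of_eq ?_) (L2.integral_norm_le (f - g) h1)
  congr 1
  rw [intervalIntegral.integral_of_le zero_le_one, intervalIntegral.integral_of_le zero_le_one,
    integral_Ioc_eq_integral_Ioo, integral_Ioc_eq_integral_Ioo]
  apply integral_congr_ae
  filter_upwards [Lp.coeFn_sub f g] with y hy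
  rw [hy, Pi.sub_apply]

/-- The real Hilbert space of complex valued functions `f ∈ H²(0,1)` with
`f(0) = f'(0) = f'(1) = 0`, with the norm of `H²(0,1)`. -/
def H2Zero : Submodule ℝ L2Triple where
  carrier := {t | IsH2Zero t}
  zero_mem' := by
    rw [mem_ofPred_eq, isH2Zero_iff]
    have h := L2.integral_norm_le 0 (x := 1) ⟨zero_le_one, le_rfl⟩
    rw [norm_zero, norm_le_zero_iff] at h
    exact ⟨(map_zero L2.volterra).symm, (map_zero L2.volterra).symm, h⟩
  add_mem' := by
    intro s t hs ht
    rw [mem_ofPred_eq, isH2Zero_iff] at *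
    have h0 : (0 : ℝ) ∈ Icc (0 : ℝ) 1 := ⟨le_rfl, zero_le_one⟩
    have h1 : (1 : ℝ) ∈ Icc (0 : ℝ) 1 := ⟨zero_le_one, le_rfl⟩
    refine ⟨?_, ?_, ?_⟩
    · rw [PiLp.add_apply, PiLp.add_apply, map_add, ← hs.1, ← ht.1]
    · rw [PiLp.add_apply, PiLp.add_apply, map_add, ← hs.2.1, ← ht.2.1]
    · have h := intervalIntegral.integral_add (L2.intervalIntegrable (s 2) h0 h1)
        (L2.intervalIntegrable (t 2) h0 h1)
      rw [hs.2.2, ht.2.2, add_zero] at h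
      rw [← h, intervalIntegral.integral_of_le zero_le_one,
        intervalIntegral.integral_of_le zero_le_one,
        integral_Ioc_eq_integral_Ioo, integral_Ioc_eq_integral_Ioo]
      apply integral_congr_ae
      filter_upwards [Lp.coeFn_add (s 2) (t 2)] with y hy
      simpa using hy
  smul_mem' := by
    intro a t ht
    rw [mem_ofPred_eq, isH2Zero_iff] at *
    refine ⟨?_, ?_, ?_⟩
    · rw [PiLp.smul_apply, PiLp.smul_apply, map_smul, ← ht.1]
    · rw [PiLp.smul_apply, PiLp.smul_apply, map_smul, ← ht.2.1]
    · have h := intervalIntegral.integral_smul (μ := volume) (a := (0 : ℝ)) (b := 1) a (t 2)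
      rw [ht.2.2, smul_zero] at h
      rw [← h, intervalIntegral.integral_of_le zero_le_one,
        intervalIntegral.integral_of_le zero_le_one,
        integral_Ioc_eq_integral_Ioo, integral_Ioc_eq_integral_Ioo]
      apply integral_congr_ae
      filter_upwards [Lp.coeFn_smul a (t 2)] with y hy
      simpa using hy

lemma isClosed_H2Zero : IsClosed (H2Zero : Set L2Triple) := by
  have : (H2Zero : Set L2Triple) =
      {t | t 0 = L2.volterra (t 1) ∧ t 1 = L2.volterra (t 2) ∧
        ∫ s in (0 : ℝ)..1, t 2 s = 0} := by
    ext t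
    exact isH2Zero_iff t
  rw [this]
  have hc : ∀ i : Fin 3, Continuous fun t : L2Triple => t i := fun i => by fun_prop
  refine (isClosed_eq (hc 0) (L2.volterra.continuous.comp (hc 1))).inter
    ((isClosed_eq (hc 1) (L2.volterra.continuous.comp (hc 2))).inter ?_)
  exact isClosed_eq (L2.continuous_integral.comp (hc 2)) continuous_const

instance : CompleteSpace H2Zero := isClosed_H2Zero.completeSpace_coe

/-- The second derivative of a function in `H2Zero`. -/
def H2Zero.d2 (f : H2Zero) : ℝ → ℂ := (f : L2Triple) 2

/-- The continuous representative on `[0,1]` of the first derivative of a function in `H2Zero`. -/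
def H2Zero.d1 (f : H2Zero) (x : ℝ) : ℂ := ∫ s in (0 : ℝ)..x, H2Zero.d2 f s

lemma H2Zero.d1_ae_eq (f : H2Zero) : (f : L2Triple) 1 =ᵐ[μ01] H2Zero.d1 f := by
  have := L2.volterra_coe ((f : L2Triple) 2)
  rwa [← ((isH2Zero_iff _).1 f.2).2.1] at this

/-- The real Hilbert space `H = L²((k₁,k₂); H²(0,1))` with the boundary conditions
`f(0,k) = f'(0,k) = f'(1,k) = 0`, whose squared norm is `∫ ‖f(·,k)‖²_{H²(0,1)} dk`. -/
abbrev HSpace (k₁ k₂ : ℝ) : Type := Lp H2Zero 2 (volume.restrict (Ioo k₁ k₂))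

/-! ### The forward problem and the exact data -/

/-- Admissible coefficients: `c ∈ C²(ℝ)`, `c ≥ 1`, and `c = 1` outside `(0,1)`. -/
def IsCoefficient (c : ℝ → ℝ) : Prop :=
  ContDiff ℝ 2 c ∧ (∀ x, 1 ≤ c x) ∧ ∀ x ∉ Ioo (0 : ℝ) 1, c x = 1

/-- `u` solves `u'' + k² c u = -δ(x - x₀)` on the line, with the radiation conditions
`u' + iku → 0` at `+∞` and `u' - iku → 0` at `-∞`. The point source means that `u` is continuous,
solves the homogeneous equation off `x₀`, and that `u'` jumps by `-1` at `x₀`. -/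
structure IsForwardSolution (c : ℝ → ℝ) (x₀ k : ℝ) (u : ℝ → ℂ) : Prop where
  continuous : Continuous u
  differentiableAt : ∀ x, x ≠ x₀ → DifferentiableAt ℝ u x
  equation : ∀ x, x ≠ x₀ → HasDerivAt (deriv u) (-((k : ℂ) ^ 2 * (c x : ℂ) * u x)) x
  jump : ∃ a b : ℂ, Tendsto (deriv u) (𝓝[>] x₀) (𝓝 a) ∧ Tendsto (deriv u) (𝓝[<] x₀) (𝓝 b) ∧
    a - b = -1
  radiation_right : Tendsto (fun x => deriv u x + Complex.I * k * u x) atTop (𝓝 0)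
  radiation_left : Tendsto (fun x => deriv u x - Complex.I * k * u x) atBot (𝓝 0)

/-- The solution of the forward problem for `c = 1`. -/
def u₀ (x₀ x k : ℝ) : ℂ :=
  Complex.exp (-(Complex.I * k * |x - x₀|)) / (2 * Complex.I * k)

/-- `ψ x k = log w(x,k)` for `x ∈ [0,1]`, `k > 0`: the branch of the logarithm that is continuous
in `k` and whose difference from `-¼ ln c(x) - ik(∫_{x₀}^x √c dξ - x + x₀)` tends to `0` as
`k → ∞`. -/
structure IsLog (c : ℝ → ℝ) (x₀ : ℝ) (w ψ : ℝ → ℝ → ℂ) : Prop where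
  exp_eq : ∀ x ∈ Icc (0 : ℝ) 1, ∀ k, 0 < k → Complex.exp (ψ x k) = w x k
  continuousOn : ∀ x ∈ Icc (0 : ℝ) 1, ContinuousOn (ψ x) (Ioi 0)
  asymptotics : ∀ x ∈ Icc (0 : ℝ) 1,
    Tendsto (fun k : ℝ => ψ x k - (-(1 / 4 : ℂ) * (Real.log (c x) : ℂ) -
      Complex.I * k * (((∫ ξ in x₀..x, √(c ξ)) - x + x₀ : ℝ) : ℂ))) atTop (𝓝 0)

/-- `c` is an admissible coefficient, `w = u / u₀` where `u(·,k)` solves the forward problem with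
coefficient `c` for every `k > 0`, and `ψ = log w`. -/
structure IsExact (x₀ : ℝ) (c : ℝ → ℝ) (w ψ : ℝ → ℝ → ℂ) : Prop where
  coefficient : IsCoefficient c
  forward : ∃ u : ℝ → ℝ → ℂ, (∀ k, 0 < k → IsForwardSolution c x₀ k fun x => u x k) ∧
    ∀ x k, 0 < k → w x k = u x k / u₀ x₀ x k
  log : IsLog c x₀ w ψ

/-- Noisy data `g` on `[k₁,k₂]`, with logarithm `ℓ`, at distance at most `δ` from the exact data
`g*(k) = w(0,k)`, with logarithm `log g*(k) = ψ(0,k)`. -/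
structure IsNoisyData (k₁ k₂ δ : ℝ) (w ψ : ℝ → ℝ → ℂ) (g ℓ : ℝ → ℂ) : Prop where
  contDiffOn : ContDiffOn ℝ 1 ℓ (Icc k₁ k₂)
  exp_eq : ∀ k ∈ Icc k₁ k₂, Complex.exp (ℓ k) = g k
  log_le : ∀ k ∈ Icc k₁ k₂, ‖ℓ k - ψ 0 k‖ ≤ δ
  le : ∀ k ∈ Icc k₁ k₂, ‖g k - w 0 k‖ ≤ δ
  deriv_le : ∀ k ∈ Icc k₁ k₂,
    ‖derivWithin g (Icc k₁ k₂) k - derivWithin (w 0) (Icc k₁ k₂) k‖ ≤ δ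

/-- The boundary value `p₀ = ∂_k (log g / k²)`. -/
def p₀ (k₁ k₂ : ℝ) (ℓ : ℝ → ℂ) (k : ℝ) : ℂ :=
  derivWithin (fun κ : ℝ => ℓ κ / (κ : ℂ) ^ 2) (Icc k₁ k₂) k

/-- The boundary value `p₁ = ∂_k [(2i/k)(1 - 1/g)]`. -/
def p₁ (k₁ k₂ : ℝ) (g : ℝ → ℂ) (k : ℝ) : ℂ :=
  derivWithin (fun κ : ℝ => 2 * Complex.I / κ * (1 - 1 / g κ)) (Icc k₁ k₂) k

/-! ### The tail function -/

/-- A complex valued function `val` of class `H³(0,1)` (its continuous representative), together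
with its derivatives: `d1` and `d2` are the continuous representatives of the first two, and
`d3 ∈ L²(0,1)` is the third. -/
structure H3Fun where
  val : ℝ → ℂ
  d1 : ℝ → ℂ
  d2 : ℝ → ℂ
  d3 : ℝ → ℂ
  prim1 : IsPrimitive val d1
  prim2 : IsPrimitive d1 d2
  prim3 : IsPrimitive d2 d3
  memLp : MemLp d3 2 μ01

/-- The squared norm of `H³(0,1)`. -/
def H3Fun.normSq (V : H3Fun) : ℝ :=
  ∫ x in (0 : ℝ)..1, (‖V.val x‖ ^ 2 + ‖V.d1 x‖ ^ 2 + ‖V.d2 x‖ ^ 2 + ‖V.d3 x‖ ^ 2)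

/-- The quasi-reversibility functional
`½ (‖V''‖²_{L²(0,1)} + α ‖V‖²_{H³(0,1)})`. -/
def qrm (α : ℝ) (V : H3Fun) : ℝ :=
  1 / 2 * ((∫ x in (0 : ℝ)..1, ‖V.d2 x‖ ^ 2) + α * V.normSq)

/-- The boundary conditions on the tail function at the wave number `k₂`. -/
def IsTailCandidate (k₂ : ℝ) (g ℓ : ℝ → ℂ) (V : H3Fun) : Prop :=
  V.val 0 = ℓ k₂ / (k₂ : ℂ) ^ 2 ∧ V.d1 0 = Complex.I / k₂ * (1 - 1 / g k₂) ∧ V.d1 1 = 0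

/-- `V` minimizes the quasi-reversibility functional under the boundary conditions. -/
def IsTailMinimizer (k₂ α : ℝ) (g ℓ : ℝ → ℂ) (V : H3Fun) : Prop :=
  IsTailCandidate k₂ g ℓ V ∧ ∀ U, IsTailCandidate k₂ g ℓ U → qrm α V ≤ qrm α U

/-! ### The weighted cost functional and the gradient projection method -/

/-- The boundary value correction `m = (x² - 1)² p₀(k) + x (x² - 1)² p₁(k)`. -/
def mFun (P₀ P₁ : ℝ → ℂ) (x k : ℝ) : ℂ :=
  ((x : ℂ) ^ 2 - 1) ^ 2 * P₀ k + x * ((x : ℂ) ^ 2 - 1) ^ 2 * P₁ k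

/-- `(p' + m')(x,k)`, with `'` the derivative in `x`. -/
def qx {k₁ k₂ : ℝ} (P₀ P₁ : ℝ → ℂ) (p : HSpace k₁ k₂) (x k : ℝ) : ℂ :=
  H2Zero.d1 (p k) x + deriv (fun y => mFun P₀ P₁ y k) x

/-- `(p'' + m'')(x,k)`, with `'` the derivative in `x`. -/
def qxx {k₁ k₂ : ℝ} (P₀ P₁ : ℝ → ℂ) (p : HSpace k₁ k₂) (x k : ℝ) : ℂ :=
  H2Zero.d2 (p k) x + deriv (deriv fun y => mFun P₀ P₁ y k) x

/-- `-∫_k^{k₂} (p' + m')(x,τ) dτ + V'(x)`. -/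
def vx {k₁ k₂ : ℝ} (P₀ P₁ V' : ℝ → ℂ) (p : HSpace k₁ k₂) (x k : ℝ) : ℂ :=
  -(∫ τ in k..k₂, qx P₀ P₁ p x τ) + V' x

/-- The nonlinear integro-differential operator `L(p)(x,k)`. -/
def LOp {k₁ k₂ : ℝ} (P₀ P₁ V' : ℝ → ℂ) (p : HSpace k₁ k₂) (x k : ℝ) : ℂ :=
  qxx P₀ P₁ p x k - 2 * Complex.I * k * qx P₀ P₁ p x k
    + 2 * (k : ℂ) ^ 2 * qx P₀ P₁ p x k * vx P₀ P₁ V' p x k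
    - 2 * Complex.I * vx P₀ P₁ V' p x k
    + 2 * k * vx P₀ P₁ V' p x k ^ 2

/-- The weighted cost functional
`J_λ(p) = e^{2λ} ∫_{k₁}^{k₂} ∫_0^1 |L(p)|² e^{-2λx} dx dk`. -/
def cost {k₁ k₂ : ℝ} (P₀ P₁ V' : ℝ → ℂ) (lam : ℝ) (p : HSpace k₁ k₂) : ℝ :=
  Real.exp (2 * lam) * ∫ k in k₁..k₂, ∫ x in (0 : ℝ)..1,
    ‖LOp P₀ P₁ V' p x k‖ ^ 2 * Real.exp (-2 * lam * x)

section Projection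

/-- The closed ball of radius `R` about the origin: the closure of the open ball. -/
def cball (E : Type*) [NormedAddCommGroup E] (R : ℝ) : Set E := closure (Metric.ball (0 : E) R)

lemma exists_nearest {E : Type*} [NormedAddCommGroup E] [InnerProductSpace ℝ E] [CompleteSpace E]
    {R : ℝ} (hR : 0 < R) (z : E) :
    ∃ y ∈ cball E R, ∀ y' ∈ cball E R, ‖z - y‖ ≤ ‖z - y'‖ := by
  obtain ⟨y, hy, h⟩ := exists_norm_eq_iInf_of_complete_convex (K := cball E R)
    ((Metric.nonempty_ball.2 hR).mono subset_closure) isClosed_closure.isComplete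
    (convex_ball (0 : E) R).closure z
  refine ⟨y, hy, fun y' hy' => ?_⟩
  rw [h]
  exact ciInf_le (f := fun w : cball E R => ‖z - w‖)
    ⟨0, by rintro _ ⟨w, rfl⟩; exact norm_nonneg _⟩ ⟨y', hy'⟩

/-- The projection of a Hilbert space on its closed ball of radius `R > 0`: the point of the ball
nearest to `z`. -/
def ballProj {E : Type*} [NormedAddCommGroup E] [InnerProductSpace ℝ E] [CompleteSpace E]
    {R : ℝ} (hR : 0 < R) (z : E) : E :=
  Classical.choose (exists_nearest hR z)

/-- The gradient projection iterates `p⁽ⁿ⁺¹⁾ = Q(p⁽ⁿ⁾ - γ J'(p⁽ⁿ⁾))`, started at `p`. -/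
def gradProj {E : Type*} [NormedAddCommGroup E] [InnerProductSpace ℝ E] [CompleteSpace E]
    {R : ℝ} (hR : 0 < R) (J : E → ℝ) (γ : ℝ) (p : E) : ℕ → E
  | 0 => p
  | n + 1 => ballProj hR (gradProj hR J γ p n - γ • gradient J (gradProj hR J γ p n))

end Projection

end HelmholtzCIP

end

open HelmholtzCIP

namespace HelmholtzCIP

/-! ### Projected gradient descent for strongly convex functionals on a ball of a Hilbert space. -/

section Abstract

variable {E : Type*} [NormedAddCommGroup E]

/-! The functional is `e^{2λ}` times the squared norm of `e^{-λx} L(p)` in `L²((k₁,k₂); L²(0,1))`,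
and `L` is quadratic in `p`, so `J = s ‖y₀ + A p + B p p‖²`. For such a functional the remainder
`J(p+h) - J(p) - J'(p)h` is known exactly: `s (‖A h + B p h + B h p + B h h‖² + 2⟪y₀ + A p + B p p,
B h h⟫)`. A lower bound `κ‖h‖²` for it on the ball gives strong convexity, a Lipschitz bound for the
gradient is automatic, and a step of the method is then a contraction (`gradProj_converges`,
`gradProj_converges_of_coercive`).

The lower bound is a Carleman estimate (`CarlemanModel.coercive`). The part of `L` of order two is
`p''`, and the rest involves only `p'` and `∫ p' dk`. Since `p'` is the integral of `p''` from `0`,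
its weighted sup norm is at most `(2λ)^{-1/2}` times the weighted `L²` norm of `p''`
(`norm_weight_mul_primC_le`). Large `λ` therefore makes all lower order terms small relative to
`e^{-λx} h''`. In the inner product, `B h h` contains two factors of `h`, and each absorbs one of
the two weights, so that `L(p)` is needed only in its unweighted norm. Finally `e^{-λx} ≥ e^{-λ}` on
`[0,1]`, and the prefactor `e^{2λ}` cancels this loss exactly.

The threshold for `λ` must depend only on `R`, `r*`, the wave numbers and the bound for `p₁`, so all
other data have to be bounded through these. The value `r*(0)` fixes the logarithm at `k₂`;
comparing the minimizer with a quadratic polynomial bounds `V'` (`IsTailMinimizer.norm_d1_le`).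
Conservation of energy in the forward problem gives `|w*(0,k)| ≤ 2`, hence an upper bound for the
noisy data (`IsNoisyData.norm_le_three`); with it, the formula for `p₁` can be solved for `(log
g₀)'`, and this bounds `p₀` (`norm_p₀_le`). -/

lemma zero_mem_cball {R : ℝ} (hR : 0 < R) : (0 : E) ∈ cball E R :=
  subset_closure (Metric.mem_ball_self hR)

lemma norm_le_of_mem_cball {R : ℝ} {p : E} (hp : p ∈ cball E R) : ‖p‖ ≤ R := by
  have := Metric.closure_ball_subset_closedBall hp
  simpa using this

variable [InnerProductSpace ℝ E]

lemma convex_cball {R : ℝ} : Convex ℝ (cball E R) := (convex_ball (0 : E) R).closure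

variable {Y : Type*} [NormedAddCommGroup Y] [InnerProductSpace ℝ Y]

/-- The derivative of `‖y₀ + A p + B p p‖²`. -/
lemma hasFDerivAt_norm_sq_quadratic (s : ℝ) (y₀ : Y) (A : E →L[ℝ] Y) (B : E →L[ℝ] E →L[ℝ] Y)
    (p : E) :
    HasFDerivAt (fun p => s * ‖y₀ + A p + B p p‖ ^ 2)
      ((2 * s) • (innerSL ℝ (y₀ + A p + B p p)).comp (A + B p + B.flip p)) p := by
  have h1 : HasFDerivAt (fun p => y₀ + A p + B p p) (A + B p + B.flip p) p := by
    have h2 : HasFDerivAt (fun p => B p p) (B p + B.flip p) p := by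
      have := B.hasFDerivAt_of_bilinear (hasFDerivAt_id p) (hasFDerivAt_id p)
      exact this.congr_fderiv (ContinuousLinearMap.ext fun h => rfl)
    have := (A.hasFDerivAt.const_add y₀).add h2
    rwa [← add_assoc] at this
  have h3 := (h1.norm_sq).const_mul s
  refine h3.congr_fderiv (ContinuousLinearMap.ext fun h => ?_)
  show s * (2 • inner ℝ _ _) = 2 * s * inner ℝ _ _
  rw [two_nsmul]
  ring_nf

variable [CompleteSpace E]

lemma ballProj_mem {R : ℝ} (hR : 0 < R) (z : E) : ballProj hR z ∈ cball E R :=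
  (Classical.choose_spec (exists_nearest hR z)).1

/-- The obtuse angle characterization of the projection on the ball. -/
lemma inner_ballProj_le {R : ℝ} (hR : 0 < R) (z : E) {w : E} (hw : w ∈ cball E R) :
    inner ℝ (z - ballProj hR z) (w - ballProj hR z) ≤ 0 := by
  have hmem := ballProj_mem hR z
  refine (norm_eq_iInf_iff_real_inner_le_zero convex_cball hmem).1 ?_ w hw
  have : Nonempty (cball E R) := ⟨⟨_, hmem⟩⟩
  refine le_antisymm (le_ciInf fun y => ?_) (ciInf_le (f := fun w : cball E R => ‖z - w‖)
    ⟨0, by rintro _ ⟨w, rfl⟩; exact norm_nonneg _⟩ ⟨_, hmem⟩)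
  exact (Classical.choose_spec (exists_nearest hR z)).2 y y.2

/-- With `y`, `z` the projections of `a`, `b`, the two obtuse angle inequalities add up to `‖y - z‖²
≤ ⟪a - b, y - z⟫`, and Cauchy–Schwarz finishes. -/
lemma norm_ballProj_sub_le {R : ℝ} (hR : 0 < R) (a b : E) :
    ‖ballProj hR a - ballProj hR b‖ ≤ ‖a - b‖ := by
  have h1 := inner_ballProj_le hR a (ballProj_mem hR b)
  have h2 := inner_ballProj_le hR b (ballProj_mem hR a)
  set y := ballProj hR a
  set z := ballProj hR b
  have h3 : inner ℝ (y - z) (y - z) ≤ inner ℝ (a - b) (y - z) := by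
    have e : a - b = (a - y) + (y - z) - (b - z) := by abel
    have e1 : inner ℝ (a - y) (z - y) = -inner ℝ (a - y) (y - z) := by
      rw [← inner_neg_right, neg_sub]
    rw [e, inner_sub_left (a - y + (y - z)), inner_add_left]
    linarith
  rw [real_inner_self_eq_norm_sq] at h3
  have h4 := real_inner_le_norm (a - b) (y - z)
  by_contra! h
  have : 0 ≤ ‖a - b‖ := norm_nonneg _
  nlinarith

lemma inner_gradient (J : E → ℝ) (p h : E) : inner ℝ (gradient J p) h = fderiv ℝ J p h := by
  rw [gradient, InnerProductSpace.toDual_symm_apply]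

/-- Linear convergence of the gradient projection method on a ball, for a functional which is
strongly convex and has a Lipschitz continuous derivative there. -/
theorem gradProj_converges {R : ℝ} (hR : 0 < R) {J : E → ℝ} {κ Λ : ℝ} (hκ : 0 < κ)
    (hκΛ : 2 * κ < Λ)
    (hconv : ∀ p ∈ cball E R, ∀ q ∈ cball E R,
      J p + fderiv ℝ J p (q - p) + κ * ‖q - p‖ ^ 2 ≤ J q)
    (hlip : ∀ p ∈ cball E R, ∀ q ∈ cball E R, ∀ h,
      fderiv ℝ J p h - fderiv ℝ J q h ≤ Λ * ‖p - q‖ * ‖h‖) :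
    ∃ pmin ∈ cball E R, IsMinOn J (cball E R) pmin ∧
      (∀ p ∈ cball E R, IsMinOn J (cball E R) p → p = pmin) ∧
      ∀ γ ∈ Ioo 0 (4 * κ / Λ ^ 2), ∀ p ∈ cball E R,
        Tendsto (gradProj hR J γ p) atTop (𝓝 pmin) ∧
        ∀ n : ℕ, ‖gradProj hR J γ p n - pmin‖ ≤
          √(1 - 4 * κ * γ + Λ ^ 2 * γ ^ 2) ^ n * ‖p - pmin‖ := by
  have hΛ : 0 < Λ := by linarith
  set K := cball E R with hK
  have hgrad : ∀ p ∈ K, ∀ q ∈ K, ‖gradient J p - gradient J q‖ ≤ Λ * ‖p - q‖ := by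
    intro p hp q hq
    have h := hlip p hp q hq (gradient J p - gradient J q)
    rw [← inner_gradient, ← inner_gradient, ← inner_sub_left, real_inner_self_eq_norm_sq] at h
    by_contra! h'
    have : 0 ≤ Λ * ‖p - q‖ := by positivity
    nlinarith
  -- Add the convexity inequality to itself with `p` and `q` exchanged; the values of `J` cancel.
  have hmono : ∀ p ∈ K, ∀ q ∈ K,
      2 * κ * ‖p - q‖ ^ 2 ≤ inner ℝ (gradient J p - gradient J q) (p - q) := by
    intro p hp q hq
    have h1 := hconv p hp q hq
    have h2 := hconv q hq p hp
    rw [inner_sub_left, inner_gradient, inner_gradient]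
    rw [← neg_sub p q, map_neg, norm_neg] at h1
    linarith
  have hθ1 : ∀ γ ∈ Ioo 0 (4 * κ / Λ ^ 2), √(1 - 4 * κ * γ + Λ ^ 2 * γ ^ 2) < 1 := by
    intro γ hγ
    rw [Real.sqrt_lt' one_pos]
    have := (lt_div_iff₀ (by positivity)).1 hγ.2
    nlinarith [hγ.1]
  have hstep : ∀ γ : ℝ, 0 < γ → ∀ p ∈ K, ∀ q ∈ K,
      ‖ballProj hR (p - γ • gradient J p) - ballProj hR (q - γ • gradient J q)‖ ≤
        √(1 - 4 * κ * γ + Λ ^ 2 * γ ^ 2) * ‖p - q‖ := by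
    intro γ hγ p hp q hq
    refine (norm_ballProj_sub_le hR _ _).trans ?_
    have e : p - γ • gradient J p - (q - γ • gradient J q) =
        (p - q) - γ • (gradient J p - gradient J q) := by
      rw [smul_sub]; abel
    rw [e]
    refine le_of_sq_le_sq ?_ (by positivity)
    -- Because `2κ < Λ`, the expression is at least `(1 - 2κγ)²`.
    have hpos : 0 ≤ 1 - 4 * κ * γ + Λ ^ 2 * γ ^ 2 := by
      nlinarith [sq_nonneg (1 - 2 * κ * γ), mul_pos hγ hγ,
        mul_pos (mul_pos hγ hγ) (show 0 < Λ ^ 2 - 4 * κ ^ 2 by nlinarith)]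
    rw [mul_pow, Real.sq_sqrt hpos, norm_sub_sq_real, inner_smul_right, norm_smul,
      real_inner_comm, Real.norm_of_nonneg hγ.le]
    have h1 := hmono p hp q hq
    have h2 := hgrad p hp q hq
    have h3 : ‖gradient J p - gradient J q‖ ^ 2 ≤ (Λ * ‖p - q‖) ^ 2 :=
      pow_le_pow_left₀ (norm_nonneg _) h2 2
    have h4 : γ ^ 2 * ‖gradient J p - gradient J q‖ ^ 2 ≤ γ ^ 2 * (Λ * ‖p - q‖) ^ 2 := by gcongr
    have h5 := mul_le_mul_of_nonneg_left h1 hγ.le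
    nlinarith
  have hmem : ∀ γ p, p ∈ K → ∀ n, gradProj hR J γ p n ∈ K := by
    intro γ p hp n
    cases n with
    | zero => exact hp
    | succ n => exact ballProj_mem hR _
  -- a fixed point of one step
  obtain ⟨pm, hpm, hfix⟩ : ∃ pm ∈ K, ∃ γ : ℝ, 0 < γ ∧ ballProj hR (pm - γ • gradient J pm) = pm := by
    obtain ⟨γ, hγ⟩ : ∃ γ, γ ∈ Ioo 0 (4 * κ / Λ ^ 2) := nonempty_Ioo.2 (by positivity)
    set θ : NNReal := ⟨√(1 - 4 * κ * γ + Λ ^ 2 * γ ^ 2), Real.sqrt_nonneg _⟩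
    have hmaps : MapsTo (fun p => ballProj hR (p - γ • gradient J p)) K K :=
      fun p _ => ballProj_mem hR _
    have hcontr : ContractingWith θ (hmaps.restrict _ K K) := by
      refine ⟨?_, LipschitzWith.of_dist_le_mul fun p q => ?_⟩
      · exact_mod_cast hθ1 γ hγ
      · rw [Subtype.dist_eq, Subtype.dist_eq, dist_eq_norm, dist_eq_norm]
        exact hstep γ hγ.1 p p.2 q q.2
    obtain ⟨y, hy, hfix, -⟩ := ContractingWith.exists_fixedPoint'
      (isClosed_closure : IsClosed K).isComplete hmaps hcontr (zero_mem_cball hR)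
      (edist_ne_top _ _)
    exact ⟨y, hy, γ, hγ.1, hfix⟩
  obtain ⟨γ', hγ', hfix⟩ := hfix
  -- The obtuse angle inequality at a fixed point is the first order optimality condition,
  -- multiplied by `γ' > 0`.
  have hvar : ∀ y ∈ K, 0 ≤ fderiv ℝ J pm (y - pm) := by
    intro y hy
    have h := inner_ballProj_le hR (pm - γ' • gradient J pm) hy
    rw [hfix, sub_sub_cancel_left, inner_neg_left, real_inner_smul_left, inner_gradient] at h
    by_contra! hneg
    nlinarith
  have hmin : ∀ y ∈ K, J pm + κ * ‖y - pm‖ ^ 2 ≤ J y := by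
    intro y hy
    linarith [hconv pm hpm y hy, hvar y hy]
  -- The optimality condition does not involve the step size, so the fixed point found for one `γ'`
  -- is fixed for every `γ`. This makes the limit independent of `γ`.
  have hfixall : ∀ γ : ℝ, 0 < γ → ballProj hR (pm - γ • gradient J pm) = pm := by
    intro γ hγ
    have h := inner_ballProj_le hR (pm - γ • gradient J pm) hpm
    set y := ballProj hR (pm - γ • gradient J pm) with hy
    have hv := hvar y (ballProj_mem hR _)
    have e : pm - γ • gradient J pm - y = (pm - y) - γ • gradient J pm := by abel
    rw [e, inner_sub_left, real_inner_self_eq_norm_sq, real_inner_smul_left, inner_gradient,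
      ← neg_sub y pm, map_neg, norm_neg] at h
    have : ‖y - pm‖ ^ 2 ≤ 0 := by nlinarith
    have : ‖y - pm‖ = 0 := by nlinarith [norm_nonneg (y - pm)]
    exact sub_eq_zero.1 (norm_eq_zero.1 this)
  refine ⟨pm, hpm, fun y hy => ?_, fun p hp hpmin => ?_, fun γ hγ p hp => ?_⟩
  · have := hmin y hy
    show J pm ≤ J y
    nlinarith [sq_nonneg ‖y - pm‖]
  · have h1 := hmin p hp
    have h2 : J p ≤ J pm := hpmin hpm
    have : ‖p - pm‖ ^ 2 ≤ 0 := by nlinarith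
    have : ‖p - pm‖ = 0 := by nlinarith [norm_nonneg (p - pm)]
    exact sub_eq_zero.1 (norm_eq_zero.1 this)
  · have hrate : ∀ n : ℕ, ‖gradProj hR J γ p n - pm‖ ≤
        √(1 - 4 * κ * γ + Λ ^ 2 * γ ^ 2) ^ n * ‖p - pm‖ := by
      intro n
      induction n with
      | zero => simp [gradProj]
      | succ n ih =>
        have h := hstep γ hγ.1 _ (hmem γ p hp n) pm hpm
        rw [hfixall γ hγ.1] at h
        calc ‖gradProj hR J γ p (n + 1) - pm‖ ≤ _ := h
          _ ≤ _ := mul_le_mul_of_nonneg_left ih (Real.sqrt_nonneg _)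
          _ = _ := by rw [pow_succ]; ring
    refine ⟨?_, hrate⟩
    rw [tendsto_iff_norm_sub_tendsto_zero]
    refine squeeze_zero (fun _ => norm_nonneg _) hrate ?_
    have := (tendsto_pow_atTop_nhds_zero_of_lt_one (Real.sqrt_nonneg _) (hθ1 γ hγ)).mul_const
      ‖p - pm‖
    simpa using this

/-- The gradient projection method for `s ‖y₀ + A p + B p p‖²` under a coercivity condition. -/
theorem gradProj_converges_of_coercive {R : ℝ} (hR : 0 < R) {s κ C : ℝ} (hs : 0 < s)
    (hκ : 0 < κ) (hC : 0 ≤ C) {y₀ : Y} {A : E →L[ℝ] Y} {B : E →L[ℝ] E →L[ℝ] Y}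
    (hy₀ : ‖y₀‖ ≤ C) (hA : ‖A‖ ≤ C) (hB : ‖B‖ ≤ C)
    (hcoer : ∀ p ∈ cball E R, ∀ h, p + h ∈ cball E R →
      κ * ‖h‖ ^ 2 ≤ s * (‖A h + B p h + B h p + B h h‖ ^ 2 +
        2 * inner ℝ (y₀ + A p + B p p) (B h h)))
    {Λ : ℝ} (hΛ : Λ = 2 * κ + 1 + 2 * s *
      ((C + C * (2 * R)) * (C + C * (2 * R)) + (C + C * R + C * R * R) * (2 * C))) :
    ∃ pmin ∈ cball E R, IsMinOn (fun p => s * ‖y₀ + A p + B p p‖ ^ 2) (cball E R) pmin ∧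
      (∀ p ∈ cball E R,
        IsMinOn (fun p => s * ‖y₀ + A p + B p p‖ ^ 2) (cball E R) p → p = pmin) ∧
      ∀ γ ∈ Ioo 0 (4 * κ / Λ ^ 2), ∀ p ∈ cball E R,
        Tendsto (gradProj hR (fun p => s * ‖y₀ + A p + B p p‖ ^ 2) γ p) atTop (𝓝 pmin) ∧
        ∀ n : ℕ, ‖gradProj hR (fun p => s * ‖y₀ + A p + B p p‖ ^ 2) γ p n - pmin‖ ≤
          √(1 - 4 * κ * γ + Λ ^ 2 * γ ^ 2) ^ n * ‖p - pmin‖ := by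
  have hBn : ∀ x y, ‖B x y‖ ≤ C * ‖x‖ * ‖y‖ := fun x y =>
    (B.le_opNorm₂ x y).trans (by gcongr)
  have hAn : ∀ x, ‖A x‖ ≤ C * ‖x‖ := fun x => (A.le_opNorm x).trans (by gcongr)
  have hD : ∀ p h, fderiv ℝ (fun p => s * ‖y₀ + A p + B p p‖ ^ 2) p h =
      2 * s * inner ℝ (y₀ + A p + B p p) (A h + B p h + B h p) := by
    intro p h
    rw [(hasFDerivAt_norm_sq_quadratic s y₀ A B p).fderiv]
    rfl
  -- The summand `2κ + 1` of `Λ` serves only to guarantee `2κ < Λ`; the rest is the Lipschitz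
  -- constant.
  refine gradProj_converges hR hκ (Λ := Λ) (by rw [hΛ]; nlinarith [show 0 ≤ 2 * s *
      ((C + C * (2 * R)) * (C + C * (2 * R)) + (C + C * R + C * R * R) * (2 * C)) by positivity])
      ?_ ?_
  · intro p hp q hq
    have h := hcoer p hp (q - p) (by rwa [add_sub_cancel])
    rw [hD]
    obtain ⟨h', rfl⟩ : ∃ h', q = p + h' := ⟨q - p, by abel⟩
    rw [add_sub_cancel_left] at *
    -- Expanding the square at `p + h'` is exact: the term linear in `h'` inside the inner product
    -- is the derivative, and what remains is the left out part bounded below in `hcoer`.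
    have e : y₀ + A (p + h') + B (p + h') (p + h') =
        (y₀ + A p + B p p) + (A h' + B p h' + B h' p + B h' h') := by
      simp only [map_add, add_apply]; abel
    simp only [e]
    rw [norm_add_sq_real (y₀ + A p + B p p), inner_add_right _ _ (B h' h')]
    linarith
  · intro p hp q hq h
    have hp' := norm_le_of_mem_cball hp
    have hq' := norm_le_of_mem_cball hq
    rw [hD, hD]
    have e1 : y₀ + A p + B p p = (y₀ + A q + B q q) + (A (p - q) + B p (p - q) + B (p - q) q) := by
      simp only [map_sub, sub_apply]; abel
    have e2 : A h + B p h + B h p = A h + B q h + B h q + (B (p - q) h + B h (p - q)) := by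
      simp only [map_sub, sub_apply]; abel
    -- Product rule for differences: change the residual first, then its linearization. Each summand
    -- carries one factor `p - q`.
    have e3 : inner ℝ (y₀ + A p + B p p) (A h + B p h + B h p) -
        inner ℝ (y₀ + A q + B q q) (A h + B q h + B h q) =
        inner ℝ (A (p - q) + B p (p - q) + B (p - q) q) (A h + B p h + B h p) +
        inner ℝ (y₀ + A q + B q q) (B (p - q) h + B h (p - q)) := by
      conv_lhs => rw [e1, inner_add_left]
      nth_rewrite 1 [e2]
      rw [inner_add_right]
      ring
    have n1 : ‖A (p - q) + B p (p - q) + B (p - q) q‖ ≤ (C + C * (2 * R)) * ‖p - q‖ := by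
      have h1 := hAn (p - q)
      have h2 : ‖B p (p - q)‖ ≤ C * R * ‖p - q‖ := (hBn _ _).trans (by gcongr)
      have h3 : ‖B (p - q) q‖ ≤ C * ‖p - q‖ * R := (hBn _ _).trans (by gcongr)
      have := norm_add₃_le (a := A (p - q)) (b := B p (p - q)) (c := B (p - q) q)
      nlinarith
    have n2 : ‖A h + B p h + B h p‖ ≤ (C + C * (2 * R)) * ‖h‖ := by
      have h1 := hAn h
      have h2 : ‖B p h‖ ≤ C * R * ‖h‖ := (hBn _ _).trans (by gcongr)
      have h3 : ‖B h p‖ ≤ C * ‖h‖ * R := (hBn _ _).trans (by gcongr)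
      have := norm_add₃_le (a := A h) (b := B p h) (c := B h p)
      nlinarith
    have n3 : ‖y₀ + A q + B q q‖ ≤ C + C * R + C * R * R := by
      have h1 : ‖A q‖ ≤ C * R := (hAn q).trans (by gcongr)
      have h2 : ‖B q q‖ ≤ C * R * R := (hBn _ _).trans (by gcongr)
      have := norm_add₃_le (a := y₀) (b := A q) (c := B q q)
      linarith
    have n4 : ‖B (p - q) h + B h (p - q)‖ ≤ 2 * C * (‖p - q‖ * ‖h‖) := by
      have h1 := hBn (p - q) h
      have h2 := hBn h (p - q)
      have := norm_add_le (B (p - q) h) (B h (p - q))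
      nlinarith
    have i1 := (real_inner_le_norm (A (p - q) + B p (p - q) + B (p - q) q)
      (A h + B p h + B h p)).trans (mul_le_mul n1 n2 (norm_nonneg _) (by positivity))
    have i2 := (real_inner_le_norm (y₀ + A q + B q q) (B (p - q) h + B h (p - q))).trans
      (mul_le_mul n3 n4 (norm_nonneg _) (by positivity))
    rw [← mul_sub, e3]
    have i3 := mul_le_mul_of_nonneg_left (add_le_add i1 i2) (show 0 ≤ 2 * s by positivity)
    refine i3.trans ?_
    rw [hΛ]
    have : 0 ≤ (2 * κ + 1) * (‖p - q‖ * ‖h‖) := by positivity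
    linarith

end Abstract

end HelmholtzCIP

noncomputable section

namespace HelmholtzCIP

/-! ### Operators on functions of `x` -/

/-- Continuous complex valued functions on the unit interval. -/
abbrev CUnit : Type := C(Icc (0 : ℝ) 1, ℂ)

lemma zero_mem_Icc01 : (0 : ℝ) ∈ Icc (0 : ℝ) 1 := ⟨le_rfl, zero_le_one⟩

instance : IsProbabilityMeasure μ01 := ⟨by simp⟩

/-- The extension of a continuous function on the unit interval by constants. -/
def CUnit.ext (f : CUnit) : ℝ → ℂ := IccExtend zero_le_one f

lemma CUnit.continuous_ext (f : CUnit) : Continuous f.ext := f.continuous.Icc_extend'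

lemma CUnit.norm_ext_le (f : CUnit) (x : ℝ) : ‖f.ext x‖ ≤ ‖f‖ := f.norm_coe_le_norm _

lemma CUnit.ext_of_mem (f : CUnit) {x : ℝ} (hx : x ∈ Icc (0 : ℝ) 1) : f.ext x = f ⟨x, hx⟩ :=
  IccExtend_of_mem _ _ hx

lemma CUnit.memLp_ext_mul (φ : CUnit) (f : L2) : MemLp (fun x => φ.ext x * f x) 2 μ01 := by
  refine (Lp.memLp f).of_le_mul (c := ‖φ‖) ?_ (Eventually.of_forall fun x => ?_)
  · exact φ.continuous_ext.aestronglyMeasurable.mul (Lp.aestronglyMeasurable f)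
  · rw [norm_mul]
    gcongr
    exact φ.norm_ext_le x

/-- Multiplication by a continuous function on `L²(0,1)`. -/
def mulL2 (φ : CUnit) : L2 →L[ℝ] L2 :=
  LinearMap.mkContinuous
    { toFun := fun f => (φ.memLp_ext_mul f).toLp _
      map_add' := by
        intro f g
        rw [← MemLp.toLp_add]
        apply MemLp.toLp_congr
        filter_upwards [Lp.coeFn_add f g] with x hx
        rw [Pi.add_apply, hx, Pi.add_apply, mul_add]
      map_smul' := by
        intro a f
        rw [RingHom.id_apply, ← MemLp.toLp_const_smul]
        apply MemLp.toLp_congr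
        filter_upwards [Lp.coeFn_smul a f] with x hx
        rw [Pi.smul_apply, hx, Pi.smul_apply, mul_smul_comm] }
    ‖φ‖ (by
      intro f
      refine Lp.norm_le_mul_norm_of_ae_le_mul ?_
      filter_upwards [(φ.memLp_ext_mul f).coeFn_toLp] with x h
      refine (congrArg norm h).trans_le ?_
      rw [norm_mul]
      gcongr
      exact φ.norm_ext_le x)

lemma mulL2_coe (φ : CUnit) (f : L2) : mulL2 φ f =ᵐ[μ01] fun x => φ.ext x * f x :=
  (φ.memLp_ext_mul f).coeFn_toLp

lemma norm_mulL2_le (φ : CUnit) : ‖mulL2 φ‖ ≤ ‖φ‖ :=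
  LinearMap.mkContinuous_norm_le _ (norm_nonneg _) _

lemma CUnit.memLp_ext (f : CUnit) : MemLp f.ext 2 μ01 :=
  MemLp.of_bound f.continuous_ext.aestronglyMeasurable ‖f‖ (Eventually.of_forall f.norm_ext_le)

/-- The inclusion of continuous functions in `L²(0,1)`. -/
def toL2 : CUnit →L[ℝ] L2 :=
  LinearMap.mkContinuous
    { toFun := fun f => f.memLp_ext.toLp _
      map_add' := by
        intro f g
        rw [← MemLp.toLp_add]
        rfl
      map_smul' := by
        intro a f
        rw [RingHom.id_apply, ← MemLp.toLp_const_smul]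
        rfl }
    1 (by
      intro f
      rw [one_mul]
      refine (Lp.norm_le_of_ae_bound (norm_nonneg f) ?_).trans (by simp [measureUnivNNReal])
      filter_upwards [f.memLp_ext.coeFn_toLp] with x h
      exact (congrArg norm h).trans_le (f.norm_ext_le x))

lemma toL2_coe (f : CUnit) : toL2 f =ᵐ[μ01] f.ext := f.memLp_ext.coeFn_toLp

lemma norm_toL2_le : ‖toL2‖ ≤ 1 := LinearMap.mkContinuous_norm_le _ zero_le_one _

lemma mulL2_toL2 (φ f : CUnit) : mulL2 φ (toL2 f) = toL2 (φ * f) := by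
  apply Lp.ext
  filter_upwards [mulL2_coe φ (toL2 f), toL2_coe f, toL2_coe (φ * f)] with x h1 h2 h3
  rw [h1, h2, h3]
  rfl

lemma integral_congr_ae_L2 {f g : ℝ → ℂ} (h : f =ᵐ[μ01] g) {x : ℝ} (hx : x ∈ Icc (0 : ℝ) 1) :
    ∫ s in (0 : ℝ)..x, f s = ∫ s in (0 : ℝ)..x, g s := by
  rw [intervalIntegral.integral_of_le hx.1, intervalIntegral.integral_of_le hx.1,
    integral_Ioc_eq_integral_Ioo, integral_Ioc_eq_integral_Ioo]
  exact integral_congr_ae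
    (h.filter_mono (ae_mono (Measure.restrict_mono (Ioo_subset_Ioo le_rfl hx.2) le_rfl)))

/-- The integration operator `f ↦ ∫₀ˣ f` from `L²(0,1)` to continuous functions. -/
def primC : L2 →L[ℝ] CUnit :=
  LinearMap.mkContinuous
    { toFun := fun f => ⟨fun x => ∫ s in (0 : ℝ)..x, f s, by
        have := continuousOn_iff_continuous_domRestrict.1 (L2.continuousOn_integral f)
        exact this⟩
      map_add' := by
        intro f g
        ext x
        show ∫ s in (0 : ℝ)..x, (f + g) s = (∫ s in (0 : ℝ)..x, f s) + ∫ s in (0 : ℝ)..x, g s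
        rw [← intervalIntegral.integral_add (L2.intervalIntegrable f zero_mem_Icc01 x.2)
          (L2.intervalIntegrable g zero_mem_Icc01 x.2)]
        exact integral_congr_ae_L2 (Lp.coeFn_add f g) x.2
      map_smul' := by
        intro a f
        ext x
        show ∫ s in (0 : ℝ)..x, (a • f) s = a • ∫ s in (0 : ℝ)..x, f s
        rw [← intervalIntegral.integral_smul]
        exact integral_congr_ae_L2 (Lp.coeFn_smul a f) x.2 }
    1 (by
      intro f
      rw [one_mul, ContinuousMap.norm_le _ (norm_nonneg f)]
      exact fun x => L2.integral_norm_le f x.2)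

lemma primC_apply (f : L2) (x : Icc (0 : ℝ) 1) : primC f x = ∫ s in (0 : ℝ)..x, f s := rfl

lemma norm_primC_le : ‖primC‖ ≤ 1 := LinearMap.mkContinuous_norm_le _ zero_le_one _

/-- The Carleman weight `e^{-λx}`. -/
def weight (lam : ℝ) : CUnit := ⟨fun x => (Real.exp (-lam * x) : ℂ), by fun_prop⟩

lemma weight_ext (lam : ℝ) {x : ℝ} (hx : x ∈ Icc (0 : ℝ) 1) :
    (weight lam).ext x = (Real.exp (-lam * x) : ℂ) := CUnit.ext_of_mem _ hx

lemma norm_weight_le {lam : ℝ} (hlam : 0 ≤ lam) : ‖weight lam‖ ≤ 1 := by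
  rw [ContinuousMap.norm_le _ zero_le_one]
  intro x
  show ‖(Real.exp (-lam * x) : ℂ)‖ ≤ 1
  rw [Complex.norm_real, Real.norm_of_nonneg (Real.exp_pos _).le, Real.exp_le_one_iff]
  nlinarith [x.2.1]

/-- The weight is real valued. In the coercivity proof this moves a weight from `L(p)` to the term
quadratic in the increment. -/
lemma inner_mulL2_weight (lam : ℝ) (f g : L2) :
    inner ℝ (mulL2 (weight lam) f) g = inner ℝ f (mulL2 (weight lam) g) := by
  rw [L2.inner_def, L2.inner_def]
  apply integral_congr_ae
  filter_upwards [mulL2_coe (weight lam) f, mulL2_coe (weight lam) g,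
    ae_restrict_mem measurableSet_Ioo] with x h1 h2 hx
  rw [h1, h2, weight_ext lam (Ioo_subset_Icc_self hx), ← Complex.real_smul, ← Complex.real_smul,
    real_inner_smul_left, real_inner_smul_right]

/-- The weight is smallest at `x = 1`. The loss `e^λ`, squared, is the prefactor of the cost
functional. -/
lemma norm_le_exp_mul_norm_mulL2_weight {lam : ℝ} (hlam : 0 ≤ lam) (f : L2) :
    ‖f‖ ≤ Real.exp lam * ‖mulL2 (weight lam) f‖ := by
  refine Lp.norm_le_mul_norm_of_ae_le_mul ?_
  filter_upwards [mulL2_coe (weight lam) f, ae_restrict_mem measurableSet_Ioo] with x h1 hx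
  rw [h1, weight_ext lam (Ioo_subset_Icc_self hx), norm_mul, Complex.norm_real,
    Real.norm_of_nonneg (Real.exp_pos _).le, ← mul_assoc, ← Real.exp_add]
  refine le_mul_of_one_le_left (norm_nonneg _) (Real.one_le_exp ?_)
  nlinarith [hx.2]

lemma sq_integral_mul_le {μ : Measure ℝ} {f g : ℝ → ℝ} (hf : MemLp f 2 μ) (hg : MemLp g 2 μ)
    (hf0 : 0 ≤ f) (hg0 : 0 ≤ g) :
    ∫ x, f x * g x ∂μ ≤ √(∫ x, f x ^ 2 ∂μ) * √(∫ x, g x ^ 2 ∂μ) := by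
  have h := integral_mul_le_Lp_mul_Lq_of_nonneg (μ := μ) Real.HolderConjugate.two_two
    (Eventually.of_forall hf0) (Eventually.of_forall hg0) (by simpa using hf) (by simpa using hg)
  simpa [Real.sqrt_eq_rpow] using h

lemma Lp_two_norm_sq_eq {α F : Type*} [MeasurableSpace α] {μ : Measure α} [NormedAddCommGroup F]
    (f : Lp F 2 μ) : ‖f‖ ^ 2 = ∫ x, ‖f x‖ ^ 2 ∂μ := by
  have h0 : 0 ≤ ∫ x, ‖f x‖ ^ 2 ∂μ := integral_nonneg fun _ => by positivity
  rw [Lp.norm_def, (Lp.memLp f).eLpNorm_eq_integral_rpow_norm (by norm_num) (by norm_num)]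
  simp only [ENNReal.toReal_ofNat, Real.rpow_ofNat]
  rw [ENNReal.toReal_ofReal (by positivity), ← Real.rpow_natCast, ← Real.rpow_mul h0]
  norm_num

/-- The Carleman estimate for the integration operator. -/
lemma norm_weight_mul_primC_le {lam : ℝ} (hlam : 0 < lam) (f : L2) :
    ‖weight lam * primC f‖ ≤ √(1 / (2 * lam)) * ‖mulL2 (weight lam) f‖ := by
  rw [ContinuousMap.norm_le _ (by positivity)]
  rintro ⟨x, hx⟩
  rw [ContinuousMap.mul_apply, primC_apply]
  show ‖(Real.exp (-lam * x) : ℂ) * ∫ s in (0 : ℝ)..x, f s‖ ≤ _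
  set μx : Measure ℝ := volume.restrict (Ioo 0 x) with hμx
  have hle : μx ≤ μ01 := Measure.restrict_mono (Ioo_subset_Ioo le_rfl hx.2) le_rfl
  have hm : MemLp (fun s => ‖mulL2 (weight lam) f s‖) 2 μ01 := (Lp.memLp _).norm
  have hexp : MemLp (fun s => Real.exp (-lam * (x - s))) 2 μx := by
    refine MemLp.of_bound (by fun_prop) 1 ?_
    filter_upwards [ae_restrict_mem measurableSet_Ioo] with s hs
    rw [Real.norm_of_nonneg (Real.exp_pos _).le, Real.exp_le_one_iff]
    nlinarith [hs.2]
  -- Splitting `e^{-λx} = e^{-λ(x-s)} e^{-λs}` leaves a decaying kernel whose `L²(0,x)` norm is at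
  -- most `(2λ)^{-1/2}`; Cauchy–Schwarz then gives the estimate. The weight decreases in the
  -- direction of integration, which is why the conditions at `x = 0` matter.
  have h1 : ‖(Real.exp (-lam * x) : ℂ) * ∫ s in (0 : ℝ)..x, f s‖ ≤
      ∫ s, Real.exp (-lam * (x - s)) * ‖mulL2 (weight lam) f s‖ ∂μx := by
    rw [intervalIntegral.integral_of_le hx.1, integral_Ioc_eq_integral_Ioo,
      ← integral_const_mul]
    refine (norm_integral_le_integral_norm _).trans (le_of_eq (integral_congr_ae ?_))
    filter_upwards [(mulL2_coe (weight lam) f).filter_mono (ae_mono hle),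
      ae_restrict_mem measurableSet_Ioo] with s hs hs'
    rw [hs, weight_ext lam ⟨hs'.1.le, hs'.2.le.trans hx.2⟩, norm_mul, norm_mul, Complex.norm_real,
      Complex.norm_real, Real.norm_of_nonneg (Real.exp_pos _).le,
      Real.norm_of_nonneg (Real.exp_pos _).le, ← mul_assoc, ← Real.exp_add]
    ring_nf
  refine h1.trans ((sq_integral_mul_le hexp (hm.mono_measure hle) (fun _ => (Real.exp_pos _).le)
    fun _ => norm_nonneg _).trans ?_)
  refine mul_le_mul (Real.sqrt_le_sqrt ?_) ?_ (Real.sqrt_nonneg _) (Real.sqrt_nonneg _)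
  · have hder : ∀ s ∈ uIcc 0 x, HasDerivAt (fun s => Real.exp (-lam * (x - s)) ^ 2 / (2 * lam))
        (Real.exp (-lam * (x - s)) ^ 2) s := by
      intro s _
      have h := ((((hasDerivAt_id s).const_sub x).const_mul (-lam)).exp.pow 2).div_const (2 * lam)
      refine h.congr_deriv ?_
      simp only [id]
      field_simp
      norm_num [mul_comm]
    have := intervalIntegral.integral_eq_sub_of_hasDerivAt hder
      (Continuous.intervalIntegrable (by fun_prop) _ _)
    rw [intervalIntegral.integral_of_le hx.1, integral_Ioc_eq_integral_Ioo] at this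
    rw [this, sub_self, mul_zero, Real.exp_zero, one_pow]
    have : 0 ≤ Real.exp (-lam * (x - 0)) ^ 2 / (2 * lam) := by positivity
    linarith
  · refine Real.sqrt_le_iff.2 ⟨norm_nonneg _, ?_⟩
    rw [Lp_two_norm_sq_eq]
    refine integral_mono_measure hle (Eventually.of_forall fun _ => by positivity) ?_
    exact (Lp.memLp (mulL2 (weight lam) f)).norm.integrable_sq

lemma norm_volterra_le (f : L2) : ‖L2.volterra f‖ ≤ ‖f‖ := by
  refine (L2.volterra.le_opNorm f).trans ?_
  exact mul_le_of_le_one_left (norm_nonneg _) (LinearMap.mkContinuous_norm_le _ zero_le_one _)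

/-- The second derivative as an operator from `H²` to `L²`. -/
def d2L : H2Zero →L[ℝ] L2 := (PiLp.proj 2 (fun _ : Fin 3 => L2) (2 : Fin 3)).comp H2Zero.subtypeL

lemma d2L_coe (f : H2Zero) : ⇑(d2L f) = H2Zero.d2 f := rfl

lemma primC_d2L (f : H2Zero) (x : Icc (0 : ℝ) 1) : primC (d2L f) x = H2Zero.d1 f x := rfl

lemma norm_d2L_apply_le (f : H2Zero) : ‖d2L f‖ ≤ ‖f‖ := PiLp.norm_apply_le (f : L2Triple) 2

/-- Since `f(0) = f'(0) = 0`, both `f` and `f'` are obtained from `f''` by integration from `0`,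
which does not increase the norm; so each of the three terms of `‖f‖²` is at most `‖f''‖²`. -/
lemma norm_le_norm_d2L (f : H2Zero) : ‖f‖ ≤ √3 * ‖d2L f‖ := by
  have h := (isH2Zero_iff _).1 f.2
  have h1 : ‖(f : L2Triple) 1‖ ≤ ‖d2L f‖ := by
    rw [h.2.1]; exact norm_volterra_le _
  have h0 : ‖(f : L2Triple) 0‖ ≤ ‖d2L f‖ := by
    rw [h.1]; exact (norm_volterra_le _).trans h1
  have h2 : ‖(f : L2Triple) 2‖ = ‖d2L f‖ := rfl
  have e : ‖f‖ = √(∑ i, ‖(f : L2Triple) i‖ ^ 2) := PiLp.norm_eq_of_L2 (f : L2Triple)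
  rw [e, Fin.sum_univ_three, h2]
  refine Real.sqrt_le_iff.2 ⟨by positivity, ?_⟩
  rw [mul_pow, Real.sq_sqrt (by norm_num)]
  nlinarith [norm_nonneg ((f : L2Triple) 1), norm_nonneg ((f : L2Triple) 0)]

/-! ### Operators on functions of `x` and `k` -/

/-- Lebesgue measure on the interval of wave numbers. -/
abbrev kMeasure (k₁ k₂ : ℝ) : Measure ℝ := volume.restrict (Ioo k₁ k₂)

variable {k₁ k₂ : ℝ}

lemma norm_mulCUnit_le : ‖ContinuousLinearMap.mul ℝ CUnit‖ ≤ 1 :=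
  ContinuousLinearMap.opNorm_mul_le _ _

variable (k₁ k₂) in
/-- Functions of `k` with values in `C[0,1]`, square integrable. -/
abbrev LpC : Type := Lp CUnit 2 (kMeasure k₁ k₂)

variable (k₁ k₂) in
/-- Bounded functions of `k` with values in `C[0,1]`. -/
abbrev LinfC : Type := Lp CUnit ∞ (kMeasure k₁ k₂)

variable (k₁ k₂) in
/-- Square integrable functions of `k` with values in `L²(0,1)`. -/
abbrev LpL2 : Type := Lp L2 2 (kMeasure k₁ k₂)

/-- The pointwise product. -/
def mulLp : LinfC k₁ k₂ →L[ℝ] LpC k₁ k₂ →L[ℝ] LpC k₁ k₂ :=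
  (ContinuousLinearMap.mul ℝ CUnit).holderL (kMeasure k₁ k₂) ∞ 2 2

lemma mulLp_coe (F : LinfC k₁ k₂) (f : LpC k₁ k₂) :
    mulLp F f =ᵐ[kMeasure k₁ k₂] fun k => F k * f k :=
  (ContinuousLinearMap.mul ℝ CUnit).coeFn_holder F f

lemma norm_mulLp_le (F : LinfC k₁ k₂) (f : LpC k₁ k₂) : ‖mulLp F f‖ ≤ ‖F‖ * ‖f‖ := by
  refine ((ContinuousLinearMap.mul ℝ CUnit).norm_holder_apply_apply_le F f).trans ?_
  have := norm_mulCUnit_le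
  calc _ ≤ 1 * ‖F‖ * ‖f‖ := by gcongr
    _ = _ := by rw [one_mul]

/-- Multiplication by a function of `x`. -/
def smulLp (φ : CUnit) : LpC k₁ k₂ →L[ℝ] LpC k₁ k₂ :=
  (ContinuousLinearMap.mul ℝ CUnit φ).compLpL 2 _

/-- Multiplication by a function of `x`. -/
def smulLinf (φ : CUnit) : LinfC k₁ k₂ →L[ℝ] LinfC k₁ k₂ :=
  (ContinuousLinearMap.mul ℝ CUnit φ).compLpL ∞ _

lemma smulLp_coe (φ : CUnit) (f : LpC k₁ k₂) :
    smulLp φ f =ᵐ[kMeasure k₁ k₂] fun k => φ * f k :=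
  (ContinuousLinearMap.mul ℝ CUnit φ).coeFn_compLpL f

lemma smulLinf_coe (φ : CUnit) (f : LinfC k₁ k₂) :
    smulLinf φ f =ᵐ[kMeasure k₁ k₂] fun k => φ * f k :=
  (ContinuousLinearMap.mul ℝ CUnit φ).coeFn_compLpL f

lemma smulLp_mulLp (φ : CUnit) (F : LinfC k₁ k₂) (f : LpC k₁ k₂) :
    smulLp φ (mulLp F f) = mulLp F (smulLp φ f) := by
  apply Lp.ext
  filter_upwards [smulLp_coe φ (mulLp F f), mulLp_coe F f, mulLp_coe F (smulLp φ f),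
    smulLp_coe φ f] with k h1 h2 h3 h4
  rw [h1, h2, h3, h4]
  ring

/-- Multiplication by a function of `x` can be shifted between the factors of a product, so a weight
can be placed on whichever factor contains the increment. -/
lemma mulLp_smulLinf (φ : CUnit) (F : LinfC k₁ k₂) (f : LpC k₁ k₂) :
    mulLp (smulLinf φ F) f = mulLp F (smulLp φ f) := by
  apply Lp.ext
  filter_upwards [mulLp_coe (smulLinf φ F) f, smulLinf_coe φ F, mulLp_coe F (smulLp φ f),
    smulLp_coe φ f] with k h1 h2 h3 h4
  rw [h1, h2, h3, h4]
  ring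

/-- The inclusion of `L^∞` in `L²` for functions of `k`. -/
def linfToLp : LinfC k₁ k₂ →L[ℝ] LpC k₁ k₂ := mulLp.flip (Lp.const 2 (kMeasure k₁ k₂) (1 : CUnit))

lemma linfToLp_apply (F : LinfC k₁ k₂) :
    linfToLp F = mulLp F (Lp.const 2 (kMeasure k₁ k₂) (1 : CUnit)) := rfl

lemma linfToLp_coe (F : LinfC k₁ k₂) : linfToLp F =ᵐ[kMeasure k₁ k₂] F := by
  filter_upwards [mulLp_coe F (Lp.const 2 (kMeasure k₁ k₂) (1 : CUnit)),
    Lp.coeFn_const (p := 2) (μ := kMeasure k₁ k₂) (1 : CUnit)] with k h1 h2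
  rw [linfToLp_apply, h1, h2, Function.const_apply, mul_one]

lemma kMeasure_real_univ_rpow (hk : k₁ < k₂) :
    (measureUnivNNReal (kMeasure k₁ k₂) : ℝ) ^ (2 : ℝ≥0∞).toReal⁻¹ = √(k₂ - k₁) := by
  rw [Real.sqrt_eq_rpow]
  simp [measureUnivNNReal, ENNReal.ofReal, hk.le]

lemma norm_linfToLp_le (hk : k₁ < k₂) (F : LinfC k₁ k₂) :
    ‖linfToLp F‖ ≤ √(k₂ - k₁) * ‖F‖ := by
  rw [linfToLp_apply, mul_comm]
  refine (norm_mulLp_le _ _).trans ?_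
  gcongr
  refine (Lp.norm_const_le ..).trans ?_
  rw [norm_one, one_mul, Real.sqrt_eq_rpow]
  simp [Measure.real, hk.le]

lemma smulLp_linfToLp (φ : CUnit) (F : LinfC k₁ k₂) :
    smulLp φ (linfToLp F) = linfToLp (smulLinf φ F) := by
  rw [linfToLp_apply, linfToLp_apply, smulLp_mulLp, mulLp_smulLinf]

/-- The inclusion of `C[0,1]` in `L²(0,1)`, for functions of `k`. -/
def toL2Lp : LpC k₁ k₂ →L[ℝ] LpL2 k₁ k₂ := toL2.compLpL 2 _

/-- Integration in `x`, for functions of `k`. -/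
def primLp : LpL2 k₁ k₂ →L[ℝ] LpC k₁ k₂ := primC.compLpL 2 _

/-- Multiplication by the Carleman weight, for functions of `k`. -/
def weightLp (lam : ℝ) : LpL2 k₁ k₂ →L[ℝ] LpL2 k₁ k₂ := (mulL2 (weight lam)).compLpL 2 _

/-- The second derivative in `x`, for functions of `k`. -/
def d2Lp : HSpace k₁ k₂ →L[ℝ] LpL2 k₁ k₂ := d2L.compLpL 2 _

lemma toL2Lp_coe (f : LpC k₁ k₂) : toL2Lp f =ᵐ[kMeasure k₁ k₂] fun k => toL2 (f k) :=
  toL2.coeFn_compLpL f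

lemma primLp_coe (f : LpL2 k₁ k₂) : primLp f =ᵐ[kMeasure k₁ k₂] fun k => primC (f k) :=
  primC.coeFn_compLpL f

lemma weightLp_coe (lam : ℝ) (f : LpL2 k₁ k₂) :
    weightLp lam f =ᵐ[kMeasure k₁ k₂] fun k => mulL2 (weight lam) (f k) :=
  (mulL2 (weight lam)).coeFn_compLpL f

lemma d2Lp_coe (f : HSpace k₁ k₂) : d2Lp f =ᵐ[kMeasure k₁ k₂] fun k => d2L (f k) :=
  d2L.coeFn_compLpL f

lemma norm_toL2Lp_le (f : LpC k₁ k₂) : ‖toL2Lp f‖ ≤ ‖f‖ := by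
  refine Lp.norm_le_norm_of_ae_le ?_
  filter_upwards [toL2Lp_coe f] with k h
  rw [h]
  exact (toL2.le_opNorm _).trans (mul_le_of_le_one_left (norm_nonneg _) norm_toL2_le)

lemma norm_primLp_le (f : LpL2 k₁ k₂) : ‖primLp f‖ ≤ ‖f‖ := by
  refine Lp.norm_le_norm_of_ae_le ?_
  filter_upwards [primLp_coe f] with k h
  rw [h]
  exact (primC.le_opNorm _).trans (mul_le_of_le_one_left (norm_nonneg _) norm_primC_le)

lemma norm_weightLp_le {lam : ℝ} (hlam : 0 ≤ lam) (f : LpL2 k₁ k₂) : ‖weightLp lam f‖ ≤ ‖f‖ := by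
  refine Lp.norm_le_norm_of_ae_le ?_
  filter_upwards [weightLp_coe lam f] with k h
  rw [h]
  exact ((mulL2 (weight lam)).le_opNorm _).trans (mul_le_of_le_one_left (norm_nonneg _)
    ((norm_mulL2_le _).trans (norm_weight_le hlam)))

lemma norm_d2Lp_le (f : HSpace k₁ k₂) : ‖d2Lp f‖ ≤ ‖f‖ := by
  refine Lp.norm_le_norm_of_ae_le ?_
  filter_upwards [d2Lp_coe f] with k h
  rw [h]
  exact norm_d2L_apply_le _

lemma norm_le_norm_d2Lp (f : HSpace k₁ k₂) : ‖f‖ ≤ √3 * ‖d2Lp f‖ := by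
  refine Lp.norm_le_mul_norm_of_ae_le_mul ?_
  filter_upwards [d2Lp_coe f] with k h
  rw [h]
  exact norm_le_norm_d2L _

lemma norm_le_exp_mul_norm_weightLp {lam : ℝ} (hlam : 0 ≤ lam) (f : LpL2 k₁ k₂) :
    ‖f‖ ≤ Real.exp lam * ‖weightLp lam f‖ := by
  refine Lp.norm_le_mul_norm_of_ae_le_mul ?_
  filter_upwards [weightLp_coe lam f] with k h
  rw [h]
  exact norm_le_exp_mul_norm_mulL2_weight hlam _

lemma weightLp_toL2Lp (lam : ℝ) (f : LpC k₁ k₂) :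
    weightLp lam (toL2Lp f) = toL2Lp (smulLp (weight lam) f) := by
  apply Lp.ext
  filter_upwards [weightLp_coe lam (toL2Lp f), toL2Lp_coe f,
    toL2Lp_coe (smulLp (weight lam) f), smulLp_coe (weight lam) f] with k h1 h2 h3 h4
  rw [h1, h2, h3, h4, mulL2_toL2]

lemma inner_weightLp (lam : ℝ) (f g : LpL2 k₁ k₂) :
    inner ℝ (weightLp lam f) g = inner ℝ f (weightLp lam g) := by
  rw [L2.inner_def, L2.inner_def]
  apply integral_congr_ae
  filter_upwards [weightLp_coe lam f, weightLp_coe lam g] with k h1 h2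
  rw [h1, h2, inner_mulL2_weight]

lemma norm_smulLp_weight_primLp_le {lam : ℝ} (hlam : 0 < lam) (f : LpL2 k₁ k₂) :
    ‖smulLp (weight lam) (primLp f)‖ ≤ √(1 / (2 * lam)) * ‖weightLp lam f‖ := by
  refine Lp.norm_le_mul_norm_of_ae_le_mul ?_
  filter_upwards [smulLp_coe (weight lam) (primLp f), primLp_coe f, weightLp_coe lam f]
    with k h1 h2 h3
  rw [h1, h2, h3]
  exact norm_weight_mul_primC_le hlam _

/-! ### Integration in the wave number. -/

section Integral

variable {F : Type*} [NormedAddCommGroup F]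

lemma integrable_LpK (f : Lp F 2 (kMeasure k₁ k₂)) : Integrable f (kMeasure k₁ k₂) :=
  (Lp.memLp f).integrable (by norm_num)

lemma integral_norm_LpK_le (hk : k₁ < k₂) (f : Lp F 2 (kMeasure k₁ k₂)) :
    ∫ τ, ‖f τ‖ ∂kMeasure k₁ k₂ ≤ √(k₂ - k₁) * ‖f‖ := by
  have h := sq_integral_mul_le (μ := kMeasure k₁ k₂) (f := fun _ => 1) (g := fun τ => ‖f τ‖)
    (memLp_const _) (Lp.memLp f).norm (fun _ => zero_le_one) fun _ => norm_nonneg _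
  have e : √(∫ τ, ‖f τ‖ ^ 2 ∂kMeasure k₁ k₂) = ‖f‖ := by
    rw [← Lp_two_norm_sq_eq, Real.sqrt_sq (norm_nonneg _)]
  rw [e] at h
  simpa [hk.le] using h

variable [NormedSpace ℝ F]

/-- Integration in `k` improves `L²` to `L^∞`. This keeps the products `Q' v_x` and `v_x²` square
integrable in `k`. -/
lemma norm_setIntegral_LpK_le (hk : k₁ < k₂) (f : Lp F 2 (kMeasure k₁ k₂)) (k : ℝ) :
    ‖∫ τ in Ioi k, f τ ∂kMeasure k₁ k₂‖ ≤ √(k₂ - k₁) * ‖f‖ :=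
  (norm_integral_le_integral_norm _).trans <|
    (setIntegral_le_integral (integrable_LpK f).norm
      (Eventually.of_forall fun _ => norm_nonneg _)).trans (integral_norm_LpK_le hk f)

lemma stronglyMeasurable_setIntegral_Ioi (f : Lp F 2 (kMeasure k₁ k₂)) :
    StronglyMeasurable fun k : ℝ => ∫ τ in Ioi k, f τ ∂kMeasure k₁ k₂ := by
  -- The variable lower limit becomes the indicator of `{k < τ}` in the plane, and measurability of
  -- partial integrals applies.
  have hs : MeasurableSet {q : ℝ × ℝ | q.1 < q.2} := measurableSet_lt measurable_fst measurable_snd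
  have h := (((Lp.stronglyMeasurable f).comp_measurable measurable_snd).indicator
    hs).integral_prod_right' (ν := kMeasure k₁ k₂)
  convert h using 2 with k
  rw [← integral_indicator measurableSet_Ioi]
  rfl

lemma memLp_setIntegral_Ioi (hk : k₁ < k₂) (f : Lp F 2 (kMeasure k₁ k₂)) :
    MemLp (fun k : ℝ => ∫ τ in Ioi k, f τ ∂kMeasure k₁ k₂) ∞ (kMeasure k₁ k₂) :=
  memLp_top_of_bound (stronglyMeasurable_setIntegral_Ioi f).aestronglyMeasurable _
    (Eventually.of_forall (norm_setIntegral_LpK_le hk f))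

/-- The integral `∫_k^{k₂} f(τ) dτ` as a function of `k`. -/
def intK (hk : k₁ < k₂) : Lp F 2 (kMeasure k₁ k₂) →L[ℝ] Lp F ∞ (kMeasure k₁ k₂) :=
  LinearMap.mkContinuous
    { toFun := fun f => (memLp_setIntegral_Ioi hk f).toLp _
      map_add' := by
        intro f g
        rw [← MemLp.toLp_add]
        apply MemLp.toLp_congr
        refine Eventually.of_forall fun k => ?_
        dsimp only [Pi.add_apply]
        rw [← integral_add (integrable_LpK f).restrict (integrable_LpK g).restrict]
        exact integral_congr_ae (ae_restrict_of_ae (Lp.coeFn_add f g))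
      map_smul' := by
        intro a f
        rw [RingHom.id_apply, ← MemLp.toLp_const_smul]
        apply MemLp.toLp_congr
        refine Eventually.of_forall fun k => ?_
        dsimp only [Pi.smul_apply]
        rw [← integral_smul]
        exact integral_congr_ae (ae_restrict_of_ae (Lp.coeFn_smul a f)) }
    √(k₂ - k₁) (by
      intro f
      refine (Lp.norm_le_of_ae_bound (C := √(k₂ - k₁) * ‖f‖) (by positivity) ?_).trans (by simp)
      filter_upwards [(memLp_setIntegral_Ioi hk f).coeFn_toLp] with k h
      exact (congrArg norm h).trans_le (norm_setIntegral_LpK_le hk f k))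

lemma intK_coe (hk : k₁ < k₂) (f : Lp F 2 (kMeasure k₁ k₂)) :
    intK hk f =ᵐ[kMeasure k₁ k₂] fun k => ∫ τ in Ioi k, f τ ∂kMeasure k₁ k₂ :=
  (memLp_setIntegral_Ioi hk f).coeFn_toLp

lemma norm_intK_le (hk : k₁ < k₂) (f : Lp F 2 (kMeasure k₁ k₂)) :
    ‖intK hk f‖ ≤ √(k₂ - k₁) * ‖f‖ :=
  (ContinuousLinearMap.le_opNorm _ _).trans (mul_le_mul_of_nonneg_right
    (LinearMap.mkContinuous_norm_le _ (Real.sqrt_nonneg _) _) (norm_nonneg _))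

end Integral

/-- The weight depends on `x` alone, so it passes through the integral in `k`; hence the Volterra
term in `v_x` satisfies the same Carleman estimate as `p'`, up to `√(k₂ - k₁)`. -/
lemma smulLinf_intK (hk : k₁ < k₂) (φ : CUnit) (f : LpC k₁ k₂) :
    smulLinf φ (intK hk f) = intK hk (smulLp φ f) := by
  apply Lp.ext
  filter_upwards [smulLinf_coe φ (intK hk f), intK_coe hk f, intK_coe hk (smulLp φ f)]
    with k h1 h2 h3
  rw [h1, h2, h3]
  have := ContinuousLinearMap.integral_comp_comm (ContinuousLinearMap.mul ℝ CUnit φ)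
    ((integrable_LpK f).restrict (s := Ioi k))
  rw [ContinuousLinearMap.mul_apply'] at this
  rw [← this]
  exact (integral_congr_ae (ae_restrict_of_ae (smulLp_coe φ f))).symm

/-! ### The quadratic operator and its coercivity -/

/-- Hilbert spaces `E` (the unknown) and `Y` (the residual), normed spaces `G`, `B` of functions of
lower order, the operators of the problem, and multiplication by a weight on each of the spaces. -/
structure CarlemanModel (E G B Y : Type*) [NormedAddCommGroup E] [InnerProductSpace ℝ E]
    [NormedAddCommGroup G] [NormedSpace ℝ G] [NormedAddCommGroup B] [NormedSpace ℝ B]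
    [NormedAddCommGroup Y] [InnerProductSpace ℝ Y] (σ θ ε : ℝ) where
  d2 : E →L[ℝ] Y
  dx : E →L[ℝ] G
  vl : E →L[ℝ] B
  mul : B →L[ℝ] G →L[ℝ] G
  incl : B →L[ℝ] G
  toY : G →L[ℝ] Y
  wG : G →L[ℝ] G
  wB : B →L[ℝ] B
  wY : Y →L[ℝ] Y
  norm_d2_le : ∀ h, ‖d2 h‖ ≤ ‖h‖
  norm_dx_le : ∀ h, ‖dx h‖ ≤ ‖h‖
  norm_vl_le : ∀ h, ‖vl h‖ ≤ θ * ‖h‖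
  norm_mul_le : ∀ F f, ‖mul F f‖ ≤ ‖F‖ * ‖f‖
  norm_incl_le : ∀ F, ‖incl F‖ ≤ θ * ‖F‖
  norm_toY_le : ∀ f, ‖toY f‖ ≤ ‖f‖
  norm_wY_le : ∀ y, ‖wY y‖ ≤ ‖y‖
  norm_le_d2 : ∀ h, ‖h‖ ≤ √3 * ‖d2 h‖
  norm_le_wY : ∀ y, ‖y‖ ≤ ε * ‖wY y‖
  wY_toY : ∀ f, wY (toY f) = toY (wG f)
  inner_wY : ∀ y z, inner ℝ (wY y) z = inner ℝ y (wY z)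
  wG_mul : ∀ F f, wG (mul F f) = mul F (wG f)
  mul_wB : ∀ F f, mul (wB F) f = mul F (wG f)
  wG_incl : ∀ F, wG (incl F) = incl (wB F)
  norm_wG_dx_le : ∀ h, ‖wG (dx h)‖ ≤ σ * ‖wY (d2 h)‖
  norm_wB_vl_le : ∀ h, ‖wB (vl h)‖ ≤ θ * (σ * ‖wY (d2 h)‖)

section Coercivity

variable {E G B Y : Type*} [NormedAddCommGroup E] [InnerProductSpace ℝ E]
  [NormedAddCommGroup G] [NormedSpace ℝ G] [NormedAddCommGroup B] [NormedSpace ℝ B]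
  [NormedAddCommGroup Y] [InnerProductSpace ℝ Y] {σ θ ε : ℝ}

/-- The coefficients of the operator
`p'' + m₂ + c₁ a + c₂ b a + c₃ b + c₄ b²` with `a = a₀ + p'`, `b = b₀ - ∫_k^{k₂} p'`. -/
structure Coeffs (G B : Type*) where
  c₁ : B
  c₂ : B
  c₃ : B
  c₄ : B
  b₀ : B
  a₀ : G
  m₂ : G

namespace Coeffs

/-- All coefficients, and the length of the interval, are bounded by `C`. -/
structure BoundedBy {G B : Type*} [NormedAddCommGroup G] [NormedAddCommGroup B]
    (K : Coeffs G B) (θ C : ℝ) : Prop where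
  one_le : 1 ≤ C
  length_le : θ ≤ C
  c₁_le : ‖K.c₁‖ ≤ C
  c₂_le : ‖K.c₂‖ ≤ C
  c₃_le : ‖K.c₃‖ ≤ C
  c₄_le : ‖K.c₄‖ ≤ C
  b₀_le : ‖K.b₀‖ ≤ C
  a₀_le : ‖K.a₀‖ ≤ C
  m₂_le : ‖K.m₂‖ ≤ C

/-- The worst term `c₄ b²` carries four factors bounded by multiples of `C`: the coefficient, `b`
twice, and the length factor of the inclusion. All lower powers are absorbed into `C⁴`. -/
lemma BoundedBy.pow_le_pow_four {G B : Type*} [NormedAddCommGroup G] [NormedAddCommGroup B]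
    {K : Coeffs G B} {θ C : ℝ} (hK : K.BoundedBy θ C) :
    1 ≤ C ^ 4 ∧ C ≤ C ^ 4 ∧ C ^ 2 ≤ C ^ 4 ∧ C ^ 3 ≤ C ^ 4 := by
  have h := hK.one_le
  exact ⟨one_le_pow₀ h, le_self_pow₀ h (by norm_num), pow_le_pow_right₀ h (by norm_num),
    pow_le_pow_right₀ h (by norm_num)⟩

end Coeffs

namespace CarlemanModel

variable (M : CarlemanModel E G B Y σ θ ε)

/-- The terms of order at most one. -/
def lower (K : Coeffs G B) (a : G) (b : B) : G :=
  K.m₂ + M.mul K.c₁ a + M.mul K.c₂ (M.mul b a) + M.mul K.c₃ (M.incl b) +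
    M.mul K.c₄ (M.mul b (M.incl b))

/-- The polarized difference of the terms of order at most one. -/
def lowerDiff (K : Coeffs G B) (a : G) (b b' : B) (f : G) (F : B) : G :=
  M.mul K.c₁ f + M.mul K.c₂ (M.mul b f + M.mul F a) + M.mul K.c₃ (M.incl F) +
    M.mul K.c₄ (M.mul b (M.incl F) + M.mul F (M.incl b'))

/-- The quadratic terms. -/
def lowerQuad (K : Coeffs G B) (F : B) (f : G) (F' : B) :
    G :=
  M.mul K.c₂ (M.mul F f) + M.mul K.c₄ (M.mul F (M.incl F'))

/-- The operator `L(p)`. -/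
def operator (K : Coeffs G B) (p : E) : Y :=
  M.d2 p + M.toY (M.lower K (K.a₀ + M.dx p) (K.b₀ + M.vl p))

variable {K : Coeffs G B} {C : ℝ}

lemma norm_mul_le_mul {F : B} {f : G} {x y : ℝ} (hF : ‖F‖ ≤ x) (hf : ‖f‖ ≤ y) :
    ‖M.mul F f‖ ≤ x * y :=
  (M.norm_mul_le F f).trans
    (mul_le_mul hF hf (norm_nonneg _) ((norm_nonneg _).trans hF))

lemma norm_incl_le_mul (hK : K.BoundedBy θ C) {F : B} {x : ℝ}
    (hF : ‖F‖ ≤ x) : ‖M.incl F‖ ≤ C * x :=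
  (M.norm_incl_le F).trans
    (mul_le_mul hK.length_le hF (norm_nonneg _) (zero_le_one.trans hK.one_le))

lemma norm_lower_le (hK : K.BoundedBy θ C) {a : G}
    {b : B} {x y : ℝ} (ha : ‖a‖ ≤ x) (hb : ‖b‖ ≤ y) :
    ‖M.lower K a b‖ ≤ C + C * x + C * (y * x) + C * (C * y) + C * (y * (C * y)) := by
  have hj := M.norm_incl_le_mul hK hb
  refine norm_add_le_of_le (norm_add_le_of_le (norm_add_le_of_le (norm_add_le_of_le hK.m₂_le ?_)
    ?_) ?_) ?_
  · exact M.norm_mul_le_mul hK.c₁_le ha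
  · exact M.norm_mul_le_mul hK.c₂_le (M.norm_mul_le_mul hb ha)
  · exact M.norm_mul_le_mul hK.c₃_le hj
  · exact M.norm_mul_le_mul hK.c₄_le (M.norm_mul_le_mul hb hj)

lemma norm_lowerDiff_le (hK : K.BoundedBy θ C) {a f : G}
    {b b' F : B} {x y y' z t : ℝ} (ha : ‖a‖ ≤ x) (hb : ‖b‖ ≤ y) (hb' : ‖b'‖ ≤ y')
    (hf : ‖f‖ ≤ z) (hF : ‖F‖ ≤ t) :
    ‖M.lowerDiff K a b b' f F‖ ≤
      C * z + C * (y * z + t * x) + C * (C * t) + C * (y * (C * t) + t * (C * y')) := by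
  have hj := M.norm_incl_le_mul hK hF
  have hj' := M.norm_incl_le_mul hK hb'
  refine norm_add_le_of_le (norm_add_le_of_le (norm_add_le_of_le ?_ ?_) ?_) ?_
  · exact M.norm_mul_le_mul hK.c₁_le hf
  · exact M.norm_mul_le_mul hK.c₂_le
      (norm_add_le_of_le (M.norm_mul_le_mul hb hf) (M.norm_mul_le_mul hF ha))
  · exact M.norm_mul_le_mul hK.c₃_le hj
  · exact M.norm_mul_le_mul hK.c₄_le
      (norm_add_le_of_le (M.norm_mul_le_mul hb hj) (M.norm_mul_le_mul hF hj'))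

lemma norm_lowerQuad_le (hK : K.BoundedBy θ C) {f : G}
    {F F' : B} {z t u : ℝ} (hf : ‖f‖ ≤ z) (hF : ‖F‖ ≤ t) (hF' : ‖F'‖ ≤ u) :
    ‖M.lowerQuad K F f F'‖ ≤ C * (t * z) + C * (t * (C * u)) :=
  norm_add_le_of_le (M.norm_mul_le_mul hK.c₂_le (M.norm_mul_le_mul hF hf))
    (M.norm_mul_le_mul hK.c₄_le (M.norm_mul_le_mul hF (M.norm_incl_le_mul hK hF')))

/-- Each term is linear in the increment `(f, F)`, so the weight falls on the increment and `a`,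
`b`, `b'` stay unweighted. -/
lemma wG_lowerDiff (a : G) (b b' : B) (f : G) (F : B) :
    M.wG (M.lowerDiff K a b b' f F) = M.lowerDiff K a b b' (M.wG f) (M.wB F) := by
  simp only [lowerDiff, map_add, M.wG_mul, M.mul_wB, M.wG_incl]

/-- Each term has two factors from the increment, and each takes one weight. -/
lemma wG_wG_lowerQuad (F : B) (f : G) (F' : B) :
    M.wG (M.wG (M.lowerQuad K F f F')) =
      M.lowerQuad K (M.wB F) (M.wG f) (M.wB F') := by
  simp only [lowerQuad, map_add, M.wG_mul, M.mul_wB, M.wG_incl]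

/-- The constant part of the weighted operator. -/
def constPart (K : Coeffs G B) : Y :=
  M.wY (M.toY (M.lower K K.a₀ K.b₀))

/-- The linear part of the weighted operator. -/
def linPart (K : Coeffs G B) : E →L[ℝ] Y :=
  (M.wY).comp (M.d2 + M.toY.comp
    ((M.mul K.c₁).comp M.dx +
      (M.mul K.c₂).comp ((M.mul K.b₀).comp M.dx + (M.mul.flip K.a₀).comp M.vl) +
      (M.mul K.c₃).comp (M.incl.comp M.vl) +
      (M.mul K.c₄).comp ((M.mul K.b₀).comp (M.incl.comp M.vl) +
        (M.mul.flip (M.incl K.b₀)).comp M.vl)))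

lemma linPart_apply (h : E) :
    M.linPart K h =
      M.wY (M.d2 h + M.toY (M.lowerDiff K K.a₀ K.b₀ K.b₀ (M.dx h) (M.vl h))) := rfl

lemma norm_wY_toY_le (f : G) :
    ‖M.wY (M.toY f)‖ ≤ ‖f‖ :=
  (M.norm_wY_le _).trans (M.norm_toY_le f)

lemma norm_vl_le_mul (hK : K.BoundedBy θ C) (h : E) :
    ‖M.vl h‖ ≤ C * ‖h‖ :=
  (M.norm_vl_le h).trans (by gcongr; exact hK.length_le)

lemma norm_quad_le (hK : K.BoundedBy θ C) (p q : E) :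
    ‖M.wY (M.toY (M.lowerQuad K (M.vl p) (M.dx q) (M.vl q)))‖ ≤
      (C ^ 2 + C ^ 4) * ‖p‖ * ‖q‖ := by
  refine (M.norm_wY_toY_le _).trans ((M.norm_lowerQuad_le hK (M.norm_dx_le q)
    (M.norm_vl_le_mul hK p) (M.norm_vl_le_mul hK q)).trans (le_of_eq ?_))
  ring

/-- The quadratic part of the weighted operator. -/
def quadPart (hK : K.BoundedBy θ C) :
    E →L[ℝ] E →L[ℝ] Y :=
  LinearMap.mkContinuous₂
    (LinearMap.mk₂ ℝ (fun p q => M.wY (M.toY (M.lowerQuad K (M.vl p) (M.dx q)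
        (M.vl q))))
      (fun p p' q => by
        simp only [lowerQuad, map_add, add_apply]; abel)
      (fun a p q => by
        simp only [lowerQuad, map_add, map_smul, smul_apply, smul_add])
      (fun p q q' => by
        simp only [lowerQuad, map_add]; abel)
      (fun a p q => by
        simp only [lowerQuad, map_add, map_smul, smul_add]))
    (C ^ 2 + C ^ 4) fun p q => M.norm_quad_le hK p q

lemma quadPart_apply (hK : K.BoundedBy θ C) (p q : E) : M.quadPart hK p q =
      M.wY (M.toY (M.lowerQuad K (M.vl p) (M.dx q) (M.vl q))) := rfl

lemma wY_operator (hK : K.BoundedBy θ C) (p : E) : M.wY (M.operator K p) =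
      M.constPart K + M.linPart K p + M.quadPart hK p p := by
  rw [M.linPart_apply, M.quadPart_apply, constPart, operator, ← map_add, ← map_add, add_left_comm,
    add_assoc, ← map_add, ← map_add]
  congr 3
  simp only [lower, lowerDiff, lowerQuad, map_add, add_apply]
  abel

variable {R : ℝ}

lemma norm_constPart_le (hK : K.BoundedBy θ C) :
    ‖M.constPart K‖ ≤ 7 * C ^ 4 := by
  refine (M.norm_wY_toY_le _).trans ((M.norm_lower_le hK hK.a₀_le hK.b₀_le).trans ?_)
  have := hK.pow_le_pow_four
  linarith

lemma norm_linPart_le (hK : K.BoundedBy θ C) :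
    ‖M.linPart K‖ ≤ 7 * C ^ 4 := by
  refine ContinuousLinearMap.opNorm_le_bound _ (by positivity) fun h => ?_
  rw [M.linPart_apply]
  refine (M.norm_wY_le _).trans ((norm_add_le_of_le (M.norm_d2_le h)
    ((M.norm_toY_le _).trans (M.norm_lowerDiff_le hK hK.a₀_le hK.b₀_le hK.b₀_le (M.norm_dx_le h)
      (M.norm_vl_le_mul hK h)))).trans ?_)
  have := hK.pow_le_pow_four
  -- Seven terms in all, whence the constant `7`, which also serves for the constant and quadratic
  -- parts.
  calc _ = (1 + C + C ^ 2 + 2 * C ^ 3 + 2 * C ^ 4) * ‖h‖ := by ring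
    _ ≤ 7 * C ^ 4 * ‖h‖ := by gcongr; linarith

lemma norm_quadPart_le (hK : K.BoundedBy θ C) :
    ‖M.quadPart hK‖ ≤ 7 * C ^ 4 := by
  refine (LinearMap.mkContinuous₂_norm_le _ (by positivity) _).trans ?_
  have := hK.pow_le_pow_four
  linarith

lemma norm_operator_le (hK : K.BoundedBy θ C) (hR : 0 < R)
    {p : E} (hp : ‖p‖ ≤ R) : ‖M.operator K p‖ ≤ 6 * C ^ 4 * (1 + R) ^ 2 := by
  have hC := hK.one_le
  have ha : ‖K.a₀ + M.dx p‖ ≤ C * (1 + R) := by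
    refine (norm_add_le_of_le hK.a₀_le ((M.norm_dx_le p).trans hp)).trans ?_
    nlinarith
  have hb : ‖K.b₀ + M.vl p‖ ≤ C * (1 + R) := by
    refine (norm_add_le_of_le hK.b₀_le ((M.norm_vl_le_mul hK p).trans
      (mul_le_mul_of_nonneg_left hp (by positivity)))).trans (by linarith)
  refine (norm_add_le_of_le ((M.norm_d2_le p).trans hp)
    ((M.norm_toY_le _).trans (M.norm_lower_le hK ha hb))).trans ?_
  obtain ⟨h0, h1, h2, h3⟩ := hK.pow_le_pow_four
  have hρ : 1 ≤ (1 + R) ^ 2 := one_le_pow₀ (by linarith)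
  have hρ1 : 1 + R ≤ (1 + R) ^ 2 := le_self_pow₀ (by linarith) (by norm_num)
  have e1 : R ≤ C ^ 4 * (1 + R) ^ 2 := by nlinarith
  have e2 : C ≤ C ^ 4 * (1 + R) ^ 2 := by nlinarith
  have e3 : C ^ 2 * (1 + R) ≤ C ^ 4 * (1 + R) ^ 2 := by gcongr
  have e4 : C ^ 3 * (1 + R) ^ 2 ≤ C ^ 4 * (1 + R) ^ 2 := by gcongr
  have e5 : C ^ 3 * (1 + R) ≤ C ^ 4 * (1 + R) ^ 2 := by gcongr
  linarith

/-- The Carleman estimate absorbs the terms of order at most one. -/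
lemma coercive (hK : K.BoundedBy θ C) (hR : 0 < R) (hσ0 : 0 ≤ σ)
    (hσ : 24 * C ^ 4 * (1 + R) * σ ≤ 1) (p : E) (hp : ‖p‖ ≤ R) (h : E) (hph : ‖p + h‖ ≤ R) :
    1 / 12 * ‖h‖ ^ 2 ≤ ε ^ 2 *
      (‖M.linPart K h + M.quadPart hK p h + M.quadPart hK h p + M.quadPart hK h h‖ ^ 2 +
        2 * inner ℝ (M.constPart K + M.linPart K p + M.quadPart hK p p)
          (M.quadPart hK h h)) := by
  have hC := hK.one_le
  have hC0 : 0 ≤ C := zero_le_one.trans hC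
  obtain ⟨h0, h1, h2, h3⟩ := hK.pow_le_pow_four
  set S := ‖M.wY (M.d2 h)‖ with hS
  have hS0 : 0 ≤ S := norm_nonneg _
  have hσ1 : 6 * C ^ 4 * (1 + R) * σ ≤ 1 / 4 := by linarith
  have hf : ‖M.wG (M.dx h)‖ ≤ σ * S := M.norm_wG_dx_le h
  have hF : ‖M.wB (M.vl h)‖ ≤ C * (σ * S) :=
    (M.norm_wB_vl_le h).trans (by gcongr; exact hK.length_le)
  have hvp : ‖K.b₀ + M.vl p‖ ≤ C * (1 + R) := by
    refine (norm_add_le_of_le hK.b₀_le ((M.norm_vl_le_mul hK p).trans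
      (mul_le_mul_of_nonneg_left hp hC0))).trans (by linarith)
  have hvq : ‖K.b₀ + M.vl (p + h)‖ ≤ C * (1 + R) := by
    refine (norm_add_le_of_le hK.b₀_le ((M.norm_vl_le_mul hK (p + h)).trans
      (mul_le_mul_of_nonneg_left hph hC0))).trans (by linarith)
  have haq : ‖K.a₀ + M.dx (p + h)‖ ≤ C * (1 + R) := by
    refine (norm_add_le_of_le hK.a₀_le ((M.norm_dx_le (p + h)).trans hph)).trans ?_
    nlinarith
  -- the increment
  set n := M.lowerDiff K (K.a₀ + M.dx (p + h)) (K.b₀ + M.vl p) (K.b₀ + M.vl (p + h))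
    (M.dx h) (M.vl h) with hn
  -- The mixed arguments of `n` come from telescoping: `b_q a_q - b_p a_p = b_p (a_q - a_p) + (b_q -
  -- b_p) a_q` with `q = p + h`, and similarly for `b²`. The formula is exact, so no term of second
  -- order in `h` remains to be treated here.
  have e1 : M.linPart K h + M.quadPart hK p h + M.quadPart hK h p +
        M.quadPart hK h h = M.wY (M.d2 h) + M.wY (M.toY n) := by
    rw [M.linPart_apply, M.quadPart_apply, quadPart_apply, M.quadPart_apply, ← map_add, ← map_add,
      ← map_add, ← map_add, add_assoc (M.d2 h), add_assoc (M.d2 h), add_assoc (M.d2 h),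
      ← map_add, ← map_add, ← map_add]
    congr 3
    simp only [hn, lowerDiff, lowerQuad, map_add, add_apply]
    abel
  have hn1 : ‖M.wY (M.toY n)‖ ≤ 6 * C ^ 4 * (1 + R) * σ * S := by
    rw [M.wY_toY, hn, M.wG_lowerDiff]
    refine (M.norm_toY_le _).trans ((M.norm_lowerDiff_le hK haq hvp hvq hf hF).trans ?_)
    have hρ : 1 ≤ 1 + R := by linarith
    have g1 : C ≤ C ^ 4 * (1 + R) := by nlinarith
    have g2 : C ^ 3 ≤ C ^ 4 * (1 + R) := by nlinarith
    have g3 : C ^ 3 * (1 + R) ≤ C ^ 4 * (1 + R) := by gcongr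
    have g4 : C ^ 2 * (1 + R) ≤ C ^ 4 * (1 + R) := by gcongr
    calc _ = (C + C ^ 2 * (1 + R) + C ^ 3 * (1 + R) + C ^ 3 + 2 * (C ^ 4 * (1 + R))) * (σ * S) := by
          ring
      _ ≤ (6 * (C ^ 4 * (1 + R))) * (σ * S) := by gcongr; linarith
      _ = _ := by ring
  have hX : 3 / 4 * S ≤ ‖M.wY (M.d2 h) + M.wY (M.toY n)‖ := by
    have t1 := norm_sub_le_norm_add (M.wY (M.d2 h)) (M.wY (M.toY n))
    have t2 : 6 * C ^ 4 * (1 + R) * σ * S ≤ 1 / 4 * S := by gcongr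
    linarith
  have hX2 : 9 / 16 * S ^ 2 ≤ ‖M.wY (M.d2 h) + M.wY (M.toY n)‖ ^ 2 := by
    have := pow_le_pow_left₀ (by positivity) hX 2
    linarith [show (3 / 4 * S) ^ 2 = 9 / 16 * S ^ 2 by ring]
  -- the second order term
  have hq : ‖M.wY (M.quadPart hK h h)‖ ≤ 2 * C ^ 4 * (σ * S) ^ 2 := by
    rw [M.quadPart_apply, M.wY_toY, M.wY_toY, M.wG_wG_lowerQuad]
    refine (M.norm_toY_le _).trans ((M.norm_lowerQuad_le hK hf hF hF).trans ?_)
    calc _ = (C ^ 2 + C ^ 4) * (σ * S) ^ 2 := by ring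
      _ ≤ _ := by gcongr; linarith
  -- The weight on the residual is moved to the quadratic term, so the residual enters with a bound
  -- free of `λ`, and the quadratic term is of order `σ²`.
  have hin : |inner ℝ (M.constPart K + M.linPart K p + M.quadPart hK p p)
      (M.quadPart hK h h)| ≤ 1 / 8 * S ^ 2 := by
    rw [← M.wY_operator hK, M.inner_wY]
    refine (abs_real_inner_le_norm _ _).trans ((mul_le_mul (M.norm_operator_le hK hR hp) hq
      (norm_nonneg _) (by positivity)).trans ?_)
    calc _ = 1 / 3 * (6 * C ^ 4 * (1 + R) * σ) ^ 2 * S ^ 2 := by ring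
      _ ≤ 1 / 3 * (1 / 4) ^ 2 * S ^ 2 := by gcongr
      _ ≤ _ := by nlinarith [sq_nonneg S]
  rw [e1]
  have hin' := (abs_le.1 hin).1
  have hfin : ‖h‖ ^ 2 ≤ 3 * (ε ^ 2 * S ^ 2) := by
    calc ‖h‖ ^ 2 ≤ (√3 * (ε * S)) ^ 2 :=
          pow_le_pow_left₀ (norm_nonneg _)
            ((M.norm_le_d2 h).trans (by gcongr; exact M.norm_le_wY _)) 2
      _ = _ := by
        rw [mul_pow, mul_pow, Real.sq_sqrt (by norm_num)]
  -- The remainder is at least `(9/16 - 2/8) S² ≥ S²/4`, and `‖h‖² ≤ 3 ε² S²`; this produces `1/12`,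
  -- independent of `λ`.
  calc 1 / 12 * ‖h‖ ^ 2 ≤ ε ^ 2 * (1 / 4 * S ^ 2) := by linarith
    _ ≤ _ := by
      gcongr
      linarith [sq_nonneg S]

/-- The Lipschitz constant of the gradient of the weighted cost functional. -/
def _root_.HelmholtzCIP.lipConst (C R ε : ℝ) : ℝ :=
  2 * (1 / 12) + 1 + 2 * ε ^ 2 *
    ((7 * C ^ 4 + 7 * C ^ 4 * (2 * R)) * (7 * C ^ 4 + 7 * C ^ 4 * (2 * R)) +
      (7 * C ^ 4 + 7 * C ^ 4 * R + 7 * C ^ 4 * R * R) * (2 * (7 * C ^ 4)))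

lemma differentiableAt_cost (hK : K.BoundedBy θ C) (p : E) :
    DifferentiableAt ℝ (fun p => ε ^ 2 * ‖M.wY (M.operator K p)‖ ^ 2) p := by
  simp_rw [M.wY_operator hK]
  exact (hasFDerivAt_norm_sq_quadratic _ _ _ _ _).differentiableAt

theorem gradProj_converges [CompleteSpace E] (hK : K.BoundedBy θ C) (hR : 0 < R) (hσ0 : 0 ≤ σ)
    (hε : 0 < ε) (hσ : 24 * C ^ 4 * (1 + R) * σ ≤ 1) {J : E → ℝ}
    (hJ : J = fun p => ε ^ 2 * ‖M.wY (M.operator K p)‖ ^ 2) :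
    ∃ pmin ∈ cball E R, IsMinOn J (cball E R) pmin ∧
      (∀ p ∈ cball E R, IsMinOn J (cball E R) p → p = pmin) ∧
      ∀ γ ∈ Ioo 0 (4 * (1 / 12) / lipConst C R ε ^ 2), ∀ p ∈ cball E R,
        Tendsto (gradProj hR J γ p) atTop (𝓝 pmin) ∧
        ∀ n : ℕ, ‖gradProj hR J γ p n - pmin‖ ≤
          √(1 - 4 * (1 / 12) * γ + lipConst C R ε ^ 2 * γ ^ 2) ^ n * ‖p - pmin‖ := by
  have hC := hK.one_le
  have hJ' : J = fun p => ε ^ 2 *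
      ‖M.constPart K + M.linPart K p + M.quadPart hK p p‖ ^ 2 := by
    rw [hJ]
    funext p
    rw [M.wY_operator hK]
  rw [hJ']
  refine gradProj_converges_of_coercive hR (by positivity) (by norm_num) (by positivity)
    (M.norm_constPart_le hK) (M.norm_linPart_le hK) (M.norm_quadPart_le hK)
    (fun p hp h hph => ?_) rfl
  exact M.coercive hK hR hσ0 hσ p (norm_le_of_mem_cball hp) h (norm_le_of_mem_cball hph)

end CarlemanModel

end Coercivity

/-! ### The cost functional as the norm of a quadratic operator -/

variable {k₁ k₂ : ℝ}

/-- The first derivative in `x`, for functions of `k`. -/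
def dxLp : HSpace k₁ k₂ →L[ℝ] LpC k₁ k₂ := primLp.comp d2Lp

/-- The linear part `-∫_k^{k₂} p'(x,τ) dτ` of `v_x`. -/
def vLin (hk : k₁ < k₂) : HSpace k₁ k₂ →L[ℝ] LinfC k₁ k₂ := -(intK hk).comp dxLp

lemma norm_dxLp_le (p : HSpace k₁ k₂) : ‖dxLp p‖ ≤ ‖p‖ :=
  (norm_primLp_le _).trans (norm_d2Lp_le p)

lemma vLin_apply (hk : k₁ < k₂) (p : HSpace k₁ k₂) : vLin hk p = -intK hk (dxLp p) := rfl

lemma norm_vLin_le (hk : k₁ < k₂) (p : HSpace k₁ k₂) : ‖vLin hk p‖ ≤ √(k₂ - k₁) * ‖p‖ := by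
  rw [vLin_apply, norm_neg]
  exact (norm_intK_le hk _).trans (by gcongr; exact norm_dxLp_le p)

lemma norm_smulLp_weight_dxLp_le {lam : ℝ} (hlam : 0 < lam) (p : HSpace k₁ k₂) :
    ‖smulLp (weight lam) (dxLp p)‖ ≤ √(1 / (2 * lam)) * ‖weightLp lam (d2Lp p)‖ :=
  norm_smulLp_weight_primLp_le hlam _

lemma norm_smulLinf_weight_vLin_le (hk : k₁ < k₂) {lam : ℝ} (hlam : 0 < lam)
    (p : HSpace k₁ k₂) :
    ‖smulLinf (weight lam) (vLin hk p)‖ ≤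
      √(k₂ - k₁) * (√(1 / (2 * lam)) * ‖weightLp lam (d2Lp p)‖) := by
  rw [vLin_apply, map_neg, norm_neg, smulLinf_intK]
  exact (norm_intK_le hk _).trans (by gcongr; exact norm_smulLp_weight_dxLp_le hlam p)

/-- The operators of the inverse problem, with the Carleman weight `e^{-λx}`. -/
def model (hk : k₁ < k₂) {lam : ℝ} (hlam : 0 < lam) :
    CarlemanModel (HSpace k₁ k₂) (LpC k₁ k₂) (LinfC k₁ k₂) (LpL2 k₁ k₂)
      (√(1 / (2 * lam))) (√(k₂ - k₁)) (Real.exp lam) where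
  d2 := d2Lp
  dx := dxLp
  vl := vLin hk
  mul := mulLp
  incl := linfToLp
  toY := toL2Lp
  wG := smulLp (weight lam)
  wB := smulLinf (weight lam)
  wY := weightLp lam
  norm_d2_le := norm_d2Lp_le
  norm_dx_le := norm_dxLp_le
  norm_vl_le := norm_vLin_le hk
  norm_mul_le := norm_mulLp_le
  norm_incl_le := norm_linfToLp_le hk
  norm_toY_le := norm_toL2Lp_le
  norm_wY_le := norm_weightLp_le hlam.le
  norm_le_d2 := norm_le_norm_d2Lp
  norm_le_wY := norm_le_exp_mul_norm_weightLp hlam.le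
  wY_toY := weightLp_toL2Lp lam
  inner_wY := inner_weightLp lam
  wG_mul := smulLp_mulLp _
  mul_wB := mulLp_smulLinf _
  wG_incl := smulLp_linfToLp _
  norm_wG_dx_le := norm_smulLp_weight_dxLp_le hlam
  norm_wB_vl_le := norm_smulLinf_weight_vLin_le hk hlam

/-! ### Continuous functions of the wave number as elements of `L^p`. -/

section OfContinuousOn

variable {F : Type*} [NormedAddCommGroup F]

lemma memLp_of_continuousOn {f : ℝ → F} (hf : ContinuousOn f (Icc k₁ k₂)) (p : ℝ≥0∞) :
    MemLp f p (kMeasure k₁ k₂) := by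
  obtain ⟨C, hC⟩ := isCompact_Icc.exists_bound_of_continuousOn hf
  refine MemLp.of_bound ((hf.mono Ioo_subset_Icc_self).aestronglyMeasurable measurableSet_Ioo) C ?_
  filter_upwards [ae_restrict_mem measurableSet_Ioo] with k hk
  exact hC k (Ioo_subset_Icc_self hk)

/-- A continuous function of `k` as an element of `L^p`. -/
def ofContinuousOn (p : ℝ≥0∞) {f : ℝ → F} (hf : ContinuousOn f (Icc k₁ k₂)) :
    Lp F p (kMeasure k₁ k₂) := (memLp_of_continuousOn hf p).toLp f

lemma ofContinuousOn_coe (p : ℝ≥0∞) {f : ℝ → F} (hf : ContinuousOn f (Icc k₁ k₂)) :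
    ofContinuousOn p hf =ᵐ[kMeasure k₁ k₂] f := (memLp_of_continuousOn hf p).coeFn_toLp

lemma norm_ofContinuousOn_ae_le (p : ℝ≥0∞) {f : ℝ → F} (hf : ContinuousOn f (Icc k₁ k₂)) {C : ℝ}
    (hC : ∀ k ∈ Icc k₁ k₂, ‖f k‖ ≤ C) :
    ∀ᵐ k ∂kMeasure k₁ k₂, ‖ofContinuousOn p hf k‖ ≤ C := by
  filter_upwards [ofContinuousOn_coe p hf, ae_restrict_mem measurableSet_Ioo] with k h hk
  rw [h]
  exact hC k (Ioo_subset_Icc_self hk)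

lemma norm_ofContinuousOn_top_le {f : ℝ → F} (hf : ContinuousOn f (Icc k₁ k₂)) {C : ℝ}
    (hC0 : 0 ≤ C) (hC : ∀ k ∈ Icc k₁ k₂, ‖f k‖ ≤ C) : ‖ofContinuousOn ∞ hf‖ ≤ C :=
  (Lp.norm_le_of_ae_bound hC0 (norm_ofContinuousOn_ae_le ∞ hf hC)).trans (by simp)

lemma norm_ofContinuousOn_two_le (hk : k₁ < k₂) {f : ℝ → F} (hf : ContinuousOn f (Icc k₁ k₂))
    {C : ℝ} (hC0 : 0 ≤ C) (hC : ∀ k ∈ Icc k₁ k₂, ‖f k‖ ≤ C) :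
    ‖ofContinuousOn 2 hf‖ ≤ √(k₂ - k₁) * C := by
  refine (Lp.norm_le_of_ae_bound hC0 (norm_ofContinuousOn_ae_le 2 hf hC)).trans (le_of_eq ?_)
  rw [← kMeasure_real_univ_rpow hk]

end OfContinuousOn

/-! ### The boundary correction `m` and the coefficients of the operator. -/

/-- A constant function of `x`. -/
def constC (a : ℂ) : CUnit := ContinuousMap.const _ a

lemma norm_constC_le (a : ℂ) : ‖constC a‖ ≤ ‖a‖ := by
  rw [ContinuousMap.norm_le _ (norm_nonneg _)]
  exact fun x => le_rfl

lemma continuous_constC : Continuous constC := by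
  refine continuous_iff_continuousAt.2 fun a => ?_
  rw [ContinuousAt, tendsto_iff_norm_sub_tendsto_zero]
  have h : Tendsto (fun b => ‖b - a‖) (𝓝 a) (𝓝 0) := by
    simpa using (continuous_id.sub (continuous_const (y := a))).norm.tendsto a
  exact squeeze_zero (fun _ => norm_nonneg _) (fun b => norm_constC_le (b - a)) h

/-- A polynomial with real coefficients restricted to the unit interval. -/
def polyC (φ : ℝ → ℝ) (hφ : Continuous φ) : CUnit := ⟨fun x => (φ x : ℂ), by fun_prop⟩

lemma norm_polyC_le {φ : ℝ → ℝ} (hφ : Continuous φ) {C : ℝ} (hC : 0 ≤ C)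
    (h : ∀ x ∈ Icc (0 : ℝ) 1, |φ x| ≤ C) : ‖polyC φ hφ‖ ≤ C := by
  rw [ContinuousMap.norm_le _ hC]
  intro x
  show ‖(φ x : ℂ)‖ ≤ C
  rw [Complex.norm_real]
  exact h x x.2

/-- The function `k ↦ P₀(k) φ + P₁(k) χ` with values in `C[0,1]`. -/
def combC (φ χ : CUnit) (P₀ P₁ : ℝ → ℂ) (k : ℝ) : CUnit := constC (P₀ k) * φ + constC (P₁ k) * χ

lemma continuousOn_combC (φ χ : CUnit) {P₀ P₁ : ℝ → ℂ} {s : Set ℝ} (h₀ : ContinuousOn P₀ s)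
    (h₁ : ContinuousOn P₁ s) : ContinuousOn (combC φ χ P₀ P₁) s :=
  ((continuous_constC.comp_continuousOn h₀).mul continuousOn_const).add
    ((continuous_constC.comp_continuousOn h₁).mul continuousOn_const)

lemma norm_combC_le {φ χ : CUnit} {P₀ P₁ : ℝ → ℂ} {k a b M₀ M₁ : ℝ} (hφ : ‖φ‖ ≤ a) (hχ : ‖χ‖ ≤ b)
    (h₀ : ‖P₀ k‖ ≤ M₀) (h₁ : ‖P₁ k‖ ≤ M₁) : ‖combC φ χ P₀ P₁ k‖ ≤ M₀ * a + M₁ * b :=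
  norm_add_le_of_le
    ((norm_mul_le _ _).trans (mul_le_mul ((norm_constC_le _).trans h₀) hφ (norm_nonneg _)
      ((norm_nonneg _).trans h₀)))
    ((norm_mul_le _ _).trans (mul_le_mul ((norm_constC_le _).trans h₁) hχ (norm_nonneg _)
      ((norm_nonneg _).trans h₁)))

/-- The function `m'`. -/
def mxC : (ℝ → ℂ) → (ℝ → ℂ) → ℝ → CUnit :=
  combC (polyC (fun x => 4 * x ^ 3 - 4 * x) (by fun_prop))
    (polyC (fun x => 5 * x ^ 4 - 6 * x ^ 2 + 1) (by fun_prop))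

/-- The function `m''`. -/
def mxxC : (ℝ → ℂ) → (ℝ → ℂ) → ℝ → CUnit :=
  combC (polyC (fun x => 12 * x ^ 2 - 4) (by fun_prop))
    (polyC (fun x => 20 * x ^ 3 - 12 * x) (by fun_prop))

lemma hasDerivAt_mFun (P₀ P₁ : ℝ → ℂ) (k x : ℝ) :
    HasDerivAt (fun y => mFun P₀ P₁ y k)
      ((P₀ k) * (4 * (x : ℂ) ^ 3 - 4 * x) + P₁ k * (5 * (x : ℂ) ^ 4 - 6 * (x : ℂ) ^ 2 + 1)) x := by
  have hx : HasDerivAt (fun y : ℝ => (y : ℂ)) 1 x := (hasDerivAt_id x).ofReal_comp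
  have h := ((((hx.pow 2).sub_const 1).pow 2).mul_const (P₀ k)).add
    ((hx.mul (((hx.pow 2).sub_const 1).pow 2)).mul_const (P₁ k))
  refine h.congr_deriv ?_
  simp only [Pi.pow_apply]
  push_cast
  ring

lemma deriv_mFun (P₀ P₁ : ℝ → ℂ) (k : ℝ) (x : Icc (0 : ℝ) 1) :
    deriv (fun y => mFun P₀ P₁ y k) x = mxC P₀ P₁ k x := by
  rw [(hasDerivAt_mFun P₀ P₁ k x).deriv]
  simp [mxC, combC, polyC, constC]

lemma deriv_deriv_mFun (P₀ P₁ : ℝ → ℂ) (k : ℝ) (x : Icc (0 : ℝ) 1) :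
    deriv (deriv fun y => mFun P₀ P₁ y k) x = mxxC P₀ P₁ k x := by
  have e : deriv (fun y => mFun P₀ P₁ y k) = fun x : ℝ =>
      (P₀ k) * (4 * (x : ℂ) ^ 3 - 4 * x) + P₁ k * (5 * (x : ℂ) ^ 4 - 6 * (x : ℂ) ^ 2 + 1) :=
    funext fun x => (hasDerivAt_mFun P₀ P₁ k x).deriv
  have hx : HasDerivAt (fun y : ℝ => (y : ℂ)) 1 (x : ℝ) := (hasDerivAt_id (x : ℝ)).ofReal_comp
  have h := ((((hx.pow 3).const_mul 4).sub (hx.const_mul 4)).const_mul (P₀ k)).add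
    (((((hx.pow 4).const_mul 5).sub ((hx.pow 2).const_mul 6)).add_const 1).const_mul (P₁ k))
  rw [e]
  refine (HasDerivAt.deriv h).trans ?_
  simp [mxxC, combC, polyC, constC]
  ring

/-- The continuous function `V'` on the unit interval. -/
def tailC {V' : ℝ → ℂ} (hV : ContinuousOn V' (Icc 0 1)) : CUnit :=
  ⟨fun x => V' x, continuousOn_iff_continuous_domRestrict.1 hV⟩

/-- The coefficients of the operator `L`. -/
def coeffs (hk : k₁ < k₂) {P₀ P₁ V' : ℝ → ℂ} (h₀ : ContinuousOn P₀ (Icc k₁ k₂))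
    (h₁ : ContinuousOn P₁ (Icc k₁ k₂)) (hV : ContinuousOn V' (Icc 0 1)) :
    Coeffs (LpC k₁ k₂) (LinfC k₁ k₂) where
  c₁ := ofContinuousOn ∞ (f := fun k : ℝ => constC (-2 * Complex.I * k))
    (continuous_constC.comp (by fun_prop)).continuousOn
  c₂ := ofContinuousOn ∞ (f := fun k : ℝ => constC (2 * (k : ℂ) ^ 2))
    (continuous_constC.comp (by fun_prop)).continuousOn
  c₃ := ofContinuousOn ∞ (f := fun _ : ℝ => constC (-2 * Complex.I)) continuousOn_const
  c₄ := ofContinuousOn ∞ (f := fun k : ℝ => constC (2 * (k : ℂ)))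
    (continuous_constC.comp (by fun_prop)).continuousOn
  b₀ := ofContinuousOn ∞ (f := fun _ : ℝ => tailC hV) continuousOn_const -
    intK hk (ofContinuousOn 2 (continuousOn_combC _ _ h₀ h₁ : ContinuousOn (mxC P₀ P₁) _))
  a₀ := ofContinuousOn 2 (continuousOn_combC _ _ h₀ h₁ : ContinuousOn (mxC P₀ P₁) _)
  m₂ := ofContinuousOn 2 (continuousOn_combC _ _ h₀ h₁ : ContinuousOn (mxxC P₀ P₁) _)

/-! ### Agreement of the abstract operator with the pointwise formula for `L`. -/

variable {P₀ P₁ V' : ℝ → ℂ}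

/-- As `p'(·,k)` takes values in `C[0,1]`, the exceptional set of `k` does not depend on `x`. The
integral in `k` at a fixed `x` needs this uniformity. -/
lemma firstOrder_coe (hk : k₁ < k₂) (h₀ : ContinuousOn P₀ (Icc k₁ k₂))
    (h₁ : ContinuousOn P₁ (Icc k₁ k₂)) (hV : ContinuousOn V' (Icc 0 1)) (p : HSpace k₁ k₂) :
    ∀ᵐ k ∂kMeasure k₁ k₂, ∀ x : Icc (0 : ℝ) 1,
      ((coeffs hk h₀ h₁ hV).a₀ + dxLp p) k x = qx P₀ P₁ p x k := by
  filter_upwards [Lp.coeFn_add (coeffs hk h₀ h₁ hV).a₀ (dxLp p), primLp_coe (d2Lp p), d2Lp_coe p,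
    ofContinuousOn_coe 2 (continuousOn_combC _ _ h₀ h₁ : ContinuousOn (mxC P₀ P₁) (Icc k₁ k₂))]
    with k e1 e2 e3 e4 x
  have e5 : dxLp p k = primC (d2L (p k)) := by rw [← e3]; exact e2
  have e6 : (coeffs hk h₀ h₁ hV).a₀ k = mxC P₀ P₁ k := e4
  rw [e1, Pi.add_apply, e5, e6, ContinuousMap.add_apply, primC_d2L, qx, deriv_mFun, add_comm]

lemma zeroOrder_coe (hk : k₁ < k₂) (h₀ : ContinuousOn P₀ (Icc k₁ k₂))
    (h₁ : ContinuousOn P₁ (Icc k₁ k₂)) (hV : ContinuousOn V' (Icc 0 1)) (p : HSpace k₁ k₂) :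
    ∀ᵐ k ∂kMeasure k₁ k₂, ∀ x : Icc (0 : ℝ) 1,
      ((coeffs hk h₀ h₁ hV).b₀ + vLin hk p) k x = vx P₀ P₁ V' p x k := by
  set a := (coeffs hk h₀ h₁ hV).a₀ + dxLp p with ha
  have e : (coeffs hk h₀ h₁ hV).b₀ + vLin hk p =
      ofContinuousOn ∞ (f := fun _ : ℝ => tailC hV) continuousOn_const - intK hk a := by
    rw [ha, map_add, vLin_apply, sub_add_eq_sub_sub, ← sub_eq_add_neg]
    rfl
  rw [e]
  have hqx := firstOrder_coe hk h₀ h₁ hV p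
  filter_upwards [Lp.coeFn_sub
    (ofContinuousOn ∞ (k₁ := k₁) (k₂ := k₂) (f := fun _ : ℝ => tailC hV) continuousOn_const)
    (intK hk a), intK_coe hk a, ofContinuousOn_coe ∞ (k₁ := k₁) (k₂ := k₂)
    (f := fun _ : ℝ => tailC hV) continuousOn_const, ae_restrict_mem measurableSet_Ioo]
    with k e1 e2 e3 hkm x
  rw [e1, Pi.sub_apply, e2, e3, ContinuousMap.sub_apply, vx, neg_add_eq_sub]
  congr 1
  -- Evaluation at `x` is continuous and linear on `C[0,1]`, so it commutes with the vector valued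
  -- integral.
  have h := ContinuousLinearMap.integral_comp_comm (ContinuousMap.evalCLM ℝ x)
    ((integrable_LpK a).restrict (s := Ioi k))
  refine h.symm.trans ?_
  rw [intervalIntegral.integral_of_le hkm.2.le, integral_Ioc_eq_integral_Ioo]
  have hr : (kMeasure k₁ k₂).restrict (Ioi k) = volume.restrict (Ioo k k₂) := by
    rw [Measure.restrict_restrict measurableSet_Ioi]
    congr 1
    ext τ
    simp only [mem_inter_iff, mem_Ioi, mem_Ioo]
    exact ⟨fun h => ⟨h.1, h.2.2⟩, fun h => ⟨h.1, hkm.1.trans h.1, h.2⟩⟩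
  rw [← hr]
  refine integral_congr_ae (ae_restrict_of_ae ?_)
  filter_upwards [hqx] with τ hτ
  exact hτ x

lemma operator_coe (hk : k₁ < k₂) {lam : ℝ} (hlam : 0 < lam) (h₀ : ContinuousOn P₀ (Icc k₁ k₂))
    (h₁ : ContinuousOn P₁ (Icc k₁ k₂)) (hV : ContinuousOn V' (Icc 0 1)) (p : HSpace k₁ k₂) :
    ∀ᵐ k ∂kMeasure k₁ k₂,
      (model hk hlam).operator (coeffs hk h₀ h₁ hV) p k =ᵐ[μ01] fun x => LOp P₀ P₁ V' p x k := by
  set K := coeffs hk h₀ h₁ hV with hK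
  set a := K.a₀ + dxLp p with ha
  set b := K.b₀ + vLin hk p with hb
  have eop : (model hk hlam).operator K p = d2Lp p + toL2Lp (K.m₂ + mulLp K.c₁ a +
      mulLp K.c₂ (mulLp b a) + mulLp K.c₃ (linfToLp b) + mulLp K.c₄ (mulLp b (linfToLp b))) := rfl
  rw [eop]
  set n := K.m₂ + mulLp K.c₁ a + mulLp K.c₂ (mulLp b a) + mulLp K.c₃ (linfToLp b) +
    mulLp K.c₄ (mulLp b (linfToLp b)) with hn
  have hnk : ∀ᵐ k ∂kMeasure k₁ k₂, n k = mxxC P₀ P₁ k + constC (-2 * Complex.I * k) * a k +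
      constC (2 * (k : ℂ) ^ 2) * (b k * a k) + constC (-2 * Complex.I) * b k +
      constC (2 * (k : ℂ)) * (b k * b k) := by
    filter_upwards [Lp.coeFn_add (K.m₂ + mulLp K.c₁ a + mulLp K.c₂ (mulLp b a) +
        mulLp K.c₃ (linfToLp b)) (mulLp K.c₄ (mulLp b (linfToLp b))),
      Lp.coeFn_add (K.m₂ + mulLp K.c₁ a + mulLp K.c₂ (mulLp b a)) (mulLp K.c₃ (linfToLp b)),
      Lp.coeFn_add (K.m₂ + mulLp K.c₁ a) (mulLp K.c₂ (mulLp b a)),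
      Lp.coeFn_add K.m₂ (mulLp K.c₁ a), mulLp_coe K.c₁ a, mulLp_coe K.c₂ (mulLp b a),
      mulLp_coe b a, mulLp_coe K.c₃ (linfToLp b), mulLp_coe K.c₄ (mulLp b (linfToLp b)),
      mulLp_coe b (linfToLp b), linfToLp_coe b,
      ofContinuousOn_coe 2 (continuousOn_combC _ _ h₀ h₁ : ContinuousOn (mxxC P₀ P₁) (Icc k₁ k₂)),
      ofContinuousOn_coe ∞ (k₁ := k₁) (k₂ := k₂) (f := fun k : ℝ => constC (-2 * Complex.I * k))
        (continuous_constC.comp (by fun_prop)).continuousOn,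
      ofContinuousOn_coe ∞ (k₁ := k₁) (k₂ := k₂) (f := fun k : ℝ => constC (2 * (k : ℂ) ^ 2))
        (continuous_constC.comp (by fun_prop)).continuousOn,
      ofContinuousOn_coe ∞ (k₁ := k₁) (k₂ := k₂) (f := fun _ : ℝ => constC (-2 * Complex.I))
        continuousOn_const,
      ofContinuousOn_coe ∞ (k₁ := k₁) (k₂ := k₂) (f := fun k : ℝ => constC (2 * (k : ℂ)))
        (continuous_constC.comp (by fun_prop)).continuousOn]
      with k f1 f2 f3 f4 f5 f6 f7 f8 f9 f10 f11 g0 g1 g2 g3 g4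
    have g0' : K.m₂ k = _ := g0
    have g1' : K.c₁ k = _ := g1
    have g2' : K.c₂ k = _ := g2
    have g3' : K.c₃ k = _ := g3
    have g4' : K.c₄ k = _ := g4
    rw [hn, f1, Pi.add_apply, f2, Pi.add_apply, f3, Pi.add_apply, f4, Pi.add_apply, f5, f6, f7, f8,
      f9, f10, f11, g0', g1', g2', g3', g4']
    rfl
  filter_upwards [hnk, firstOrder_coe hk h₀ h₁ hV p, zeroOrder_coe hk h₀ h₁ hV p,
    Lp.coeFn_add (d2Lp p) (toL2Lp n), d2Lp_coe p, toL2Lp_coe n] with k e1 e2 e3 e4 e5 e6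
  rw [e4, Pi.add_apply, e5, e6]
  filter_upwards [Lp.coeFn_add (d2L (p k)) (toL2 (n k)), toL2_coe (n k),
    ae_restrict_mem measurableSet_Ioo] with x i1 i2 hx
  have hx' := Ioo_subset_Icc_self hx
  have e2' := e2 ⟨x, hx'⟩
  have e3' := e3 ⟨x, hx'⟩
  have e7 := deriv_deriv_mFun P₀ P₁ k ⟨x, hx'⟩
  rw [i1, Pi.add_apply, i2, CUnit.ext_of_mem _ hx', e1, d2L_coe]
  simp only [ContinuousMap.add_apply, ContinuousMap.mul_apply]
  rw [e2', e3', ← e7, LOp, qxx]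
  simp only [constC, ContinuousMap.const_apply]
  ring

/-- The norm of `L²((k₁,k₂); L²(0,1))` unfolds to the iterated integral itself, so no joint
measurability in `(x,k)` is involved. -/
lemma cost_eq (hk : k₁ < k₂) {lam : ℝ} (hlam : 0 < lam) (h₀ : ContinuousOn P₀ (Icc k₁ k₂))
    (h₁ : ContinuousOn P₁ (Icc k₁ k₂)) (hV : ContinuousOn V' (Icc 0 1)) :
    (cost P₀ P₁ V' lam : HSpace k₁ k₂ → ℝ) = fun p => Real.exp lam ^ 2 *
      ‖(model hk hlam).wY ((model hk hlam).operator (coeffs hk h₀ h₁ hV) p)‖ ^ 2 := by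
  funext p
  set y := (model hk hlam).operator (coeffs hk h₀ h₁ hV) p with hy
  have e : (model hk hlam).wY y = weightLp lam y := rfl
  rw [e, cost, Lp_two_norm_sq_eq, ← Real.exp_nat_mul, intervalIntegral.integral_of_le hk.le,
    integral_Ioc_eq_integral_Ioo]
  congr 1
  refine integral_congr_ae ?_
  filter_upwards [weightLp_coe lam y, operator_coe hk hlam h₀ h₁ hV p] with k e1 e2
  rw [e1, Lp_two_norm_sq_eq, intervalIntegral.integral_of_le zero_le_one,
    integral_Ioc_eq_integral_Ioo]
  refine integral_congr_ae ?_
  filter_upwards [mulL2_coe (weight lam) (y k), e2, ae_restrict_mem measurableSet_Ioo]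
    with x i1 i2 hx
  rw [i1, i2, weight_ext lam (Ioo_subset_Icc_self hx), norm_mul, mul_pow, Complex.norm_real,
    Real.norm_of_nonneg (Real.exp_pos _).le, ← Real.exp_nat_mul, mul_comm]
  congr 2
  push_cast
  ring

/-! ### Uniform bounds for the coefficients. -/

/-- A bound for the coefficients in terms of bounds for the data. -/
def coeffBound (k₁ k₂ M₀ M₁ Mv : ℝ) : ℝ :=
  1 + √(k₂ - k₁) + 2 * k₂ + 2 * k₂ ^ 2 + 2 + Mv +
    (1 + √(k₂ - k₁)) * (√(k₂ - k₁) * (M₀ * 16 + M₁ * 32))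

lemma abs_le_of_mem_Icc01 {x : ℝ} (hx : x ∈ Icc (0 : ℝ) 1) : 
    |4 * x ^ 3 - 4 * x| ≤ 16 ∧ |5 * x ^ 4 - 6 * x ^ 2 + 1| ≤ 32 ∧ |12 * x ^ 2 - 4| ≤ 16 ∧
      |20 * x ^ 3 - 12 * x| ≤ 32 := by
  have h2 : x ^ 2 ≤ 1 := pow_le_one₀ hx.1 hx.2
  have h3 : x ^ 3 ≤ 1 := pow_le_one₀ hx.1 hx.2
  have h4 : x ^ 4 ≤ 1 := pow_le_one₀ hx.1 hx.2
  have h2' : 0 ≤ x ^ 2 := pow_nonneg hx.1 2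
  have h3' : 0 ≤ x ^ 3 := pow_nonneg hx.1 3
  have h4' : 0 ≤ x ^ 4 := pow_nonneg hx.1 4
  obtain ⟨h0, h1⟩ := hx
  refine ⟨?_, ?_, ?_, ?_⟩ <;> rw [abs_le] <;> constructor <;> linarith

lemma boundedBy_coeffs (hk₁ : 0 < k₁) (hk : k₁ < k₂) (h₀ : ContinuousOn P₀ (Icc k₁ k₂))
    (h₁ : ContinuousOn P₁ (Icc k₁ k₂)) (hV : ContinuousOn V' (Icc 0 1)) {M₀ M₁ Mv : ℝ}
    (hM₀ : ∀ k ∈ Icc k₁ k₂, ‖P₀ k‖ ≤ M₀) (hM₁ : ∀ k ∈ Icc k₁ k₂, ‖P₁ k‖ ≤ M₁)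
    (hMv : ∀ x ∈ Icc (0 : ℝ) 1, ‖V' x‖ ≤ Mv) :
    (coeffs hk h₀ h₁ hV).BoundedBy (√(k₂ - k₁)) (coeffBound k₁ k₂ M₀ M₁ Mv) := by
  have hk₂ : 0 < k₂ := hk₁.trans hk
  have m0 : 0 ≤ M₀ := (norm_nonneg _).trans (hM₀ k₁ ⟨le_rfl, hk.le⟩)
  have m1 : 0 ≤ M₁ := (norm_nonneg _).trans (hM₁ k₁ ⟨le_rfl, hk.le⟩)
  have mv : 0 ≤ Mv := (norm_nonneg _).trans (hMv 0 zero_mem_Icc01)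
  have hD : 0 ≤ √(k₂ - k₁) := Real.sqrt_nonneg _
  set D := √(k₂ - k₁) with hDdef
  have hm : 0 ≤ D * (M₀ * 16 + M₁ * 32) := by positivity
  have hm' : 0 ≤ D * (D * (M₀ * 16 + M₁ * 32)) := by positivity
  have hk2 : 0 ≤ k₂ ^ 2 := by positivity
  have ha : ‖ofContinuousOn 2 (continuousOn_combC _ _ h₀ h₁ :
      ContinuousOn (mxC P₀ P₁) (Icc k₁ k₂))‖ ≤ D * (M₀ * 16 + M₁ * 32) :=
    norm_ofContinuousOn_two_le hk _ (by positivity) fun k hk' => norm_combC_le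
      (norm_polyC_le _ (by norm_num) fun x hx => (abs_le_of_mem_Icc01 hx).1)
      (norm_polyC_le _ (by norm_num) fun x hx => (abs_le_of_mem_Icc01 hx).2.1)
      (hM₀ k hk') (hM₁ k hk')
  have hb : ‖(coeffs hk h₀ h₁ hV).b₀‖ ≤ Mv + D * (D * (M₀ * 16 + M₁ * 32)) := by
    refine norm_sub_le_of_le (norm_ofContinuousOn_top_le _ mv fun k _ => ?_)
      ((norm_intK_le hk _).trans (by gcongr))
    rw [ContinuousMap.norm_le _ mv]
    exact fun x => hMv x x.2
  have hkn : ∀ k ∈ Icc k₁ k₂, ‖(k : ℂ)‖ ≤ k₂ := fun k hk' => by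
    rw [Complex.norm_real, Real.norm_of_nonneg (hk₁.le.trans hk'.1)]; exact hk'.2
  have e₁ : ‖(coeffs hk h₀ h₁ hV).c₁‖ ≤ 2 * k₂ := by
    refine norm_ofContinuousOn_top_le (continuous_constC.comp (by fun_prop)).continuousOn
      (by positivity) fun k hk' => (norm_constC_le _).trans ?_
    have := hkn k hk'
    simp only [norm_mul, norm_neg, Complex.norm_I, Complex.norm_ofNat]
    linarith
  have e₂ : ‖(coeffs hk h₀ h₁ hV).c₂‖ ≤ 2 * k₂ ^ 2 := by
    refine norm_ofContinuousOn_top_le (continuous_constC.comp (by fun_prop)).continuousOn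
      (by positivity) fun k hk' => (norm_constC_le _).trans ?_
    rw [norm_mul, norm_pow, Complex.norm_ofNat]
    have := hkn k hk'
    gcongr
  have e₃ : ‖(coeffs hk h₀ h₁ hV).c₃‖ ≤ 2 := by
    refine norm_ofContinuousOn_top_le continuousOn_const
      (by positivity) fun k hk' => (norm_constC_le _).trans ?_
    simp
  have e₄ : ‖(coeffs hk h₀ h₁ hV).c₄‖ ≤ 2 * k₂ := by
    refine norm_ofContinuousOn_top_le (continuous_constC.comp (by fun_prop)).continuousOn
      (by positivity) fun k hk' => (norm_constC_le _).trans ?_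
    rw [norm_mul, Complex.norm_ofNat]
    have := hkn k hk'
    gcongr
  have hm₂ : ‖(coeffs hk h₀ h₁ hV).m₂‖ ≤ D * (M₀ * 16 + M₁ * 32) :=
    norm_ofContinuousOn_two_le hk (continuousOn_combC _ _ h₀ h₁) (by positivity) fun k hk' => norm_combC_le
      (norm_polyC_le _ (by norm_num) fun x hx => (abs_le_of_mem_Icc01 hx).2.2.1)
      (norm_polyC_le _ (by norm_num) fun x hx => (abs_le_of_mem_Icc01 hx).2.2.2)
      (hM₀ k hk') (hM₁ k hk')
  have ha' : ‖(coeffs hk h₀ h₁ hV).a₀‖ ≤ D * (M₀ * 16 + M₁ * 32) := ha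
  constructor <;> unfold coeffBound <;> linarith

/-! ### The energy bound for the forward problem -/

namespace IsForwardSolution

variable {c : ℝ → ℝ} {x₀ k : ℝ} {u : ℝ → ℂ}

/-- Away from the source and where `c = 1`, the modulus of `u' + iκu` with `κ = ±k` is constant. -/
lemma norm_deriv_add_eq (hu : IsForwardSolution c x₀ k u) {κ : ℝ} (hκ : κ ^ 2 = k ^ 2) {a b : ℝ}
    (hab : a ≤ b) (h : ∀ x ∈ Icc a b, x ≠ x₀ ∧ c x = 1) :
    ‖deriv u b + Complex.I * κ * u b‖ = ‖deriv u a + Complex.I * κ * u a‖ := by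
  -- The derivative is `e^{-iκx}(u'' + κ² u)`, which vanishes where `u'' = -k² u`. The exponential
  -- has modulus one.
  have hd : ∀ x ∈ Icc a b, HasDerivAt (fun x : ℝ => Complex.exp (-(Complex.I * κ * x)) *
      (deriv u x + Complex.I * κ * u x)) 0 x := by
    intro x hx
    obtain ⟨hx0, hc⟩ := h x hx
    have h1 : HasDerivAt (fun x : ℝ => Complex.exp (-(Complex.I * κ * x)))
        (Complex.exp (-(Complex.I * κ * x)) * (-(Complex.I * κ * 1))) x :=
      (((hasDerivAt_id x).ofReal_comp.const_mul (Complex.I * κ)).neg).cexp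
    have h2 := (hu.equation x hx0).add ((hu.differentiableAt x hx0).hasDerivAt.const_mul
      (Complex.I * κ))
    refine (h1.mul h2).congr_deriv ?_
    have hκ' : (κ : ℂ) ^ 2 = (k : ℂ) ^ 2 := by exact_mod_cast hκ
    rw [hc, ← hκ']
    push_cast
    simp only [Pi.add_apply]
    ring_nf
    rw [Complex.I_sq]
    ring
  have hconst := constant_of_has_deriv_right_zero
    (fun x hx => (hd x hx).continuousAt.continuousWithinAt)
    (fun x hx => (hd x (Ico_subset_Icc_self hx)).hasDerivWithinAt) b ⟨hab, le_rfl⟩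
  have hn := congrArg norm hconst
  simp only [norm_mul] at hn
  have he : ∀ x : ℝ, ‖Complex.exp (-(Complex.I * κ * x))‖ = 1 := by
    intro x
    rw [show -(Complex.I * κ * x) = ((-(κ * x) : ℝ) : ℂ) * Complex.I by push_cast; ring]
    exact Complex.norm_exp_ofReal_mul_I _
  rwa [he, he, one_mul, one_mul] at hn

/-- At `0` the reflected wave `A = u' + iku` cannot be stronger than the incident wave `B = u' -
iku`, and `|B| = 1`. Since `2iku = A - B`, the bound follows, uniformly in `c`. -/
lemma norm_apply_zero_le (hu : IsForwardSolution c x₀ k u) (hc : IsCoefficient c) (hx₀ : x₀ < 0)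
    (hk : 0 < k) : k * ‖u 0‖ ≤ 1 := by
  have hc1 : ∀ x ∉ Ioo (0 : ℝ) 1, c x = 1 := hc.2.2
  -- no wave comes in from the right
  have hA1 : deriv u 1 + Complex.I * k * u 1 = 0 := by
    have h : ∀ x : ℝ, 1 ≤ x → ‖deriv u x + Complex.I * k * u x‖ =
        ‖deriv u 1 + Complex.I * k * u 1‖ := fun x hx =>
      hu.norm_deriv_add_eq rfl hx fun y hy =>
        ⟨by linarith [hy.1], hc1 y fun h => by linarith [hy.1, h.2]⟩
    have h2 := hu.radiation_right.norm
    rw [norm_zero] at h2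
    have h3 : Tendsto (fun x : ℝ => ‖deriv u x + Complex.I * k * u x‖) atTop
        (𝓝 ‖deriv u 1 + Complex.I * k * u 1‖) :=
      tendsto_const_nhds.congr' (by
        filter_upwards [eventually_ge_atTop (1 : ℝ)] with x hx using (h x hx).symm)
    exact norm_eq_zero.1 (tendsto_nhds_unique h3 h2)
  -- the energy flux is constant on the right of the source
  have hW : (deriv u 1).im * (u 1).re - (deriv u 1).re * (u 1).im =
      (deriv u 0).im * (u 0).re - (deriv u 0).re * (u 0).im := by
    have hd : ∀ x ∈ Icc (0 : ℝ) 1, HasDerivAt (fun x =>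
        (deriv u x).im * (u x).re - (deriv u x).re * (u x).im) 0 x := by
      intro x hx
      have hx0 : x ≠ x₀ := by linarith [hx.1]
      have e1 := hu.equation x hx0
      have e2 := (hu.differentiableAt x hx0).hasDerivAt
      have r1 := Complex.reCLM.hasFDerivAt.comp_hasDerivAt x e1
      have i1 := Complex.imCLM.hasFDerivAt.comp_hasDerivAt x e1
      have r2 := Complex.reCLM.hasFDerivAt.comp_hasDerivAt x e2
      have i2 := Complex.imCLM.hasFDerivAt.comp_hasDerivAt x e2
      refine ((i1.mul r2).sub (r1.mul i2)).congr_deriv ?_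
      have e3 : -((k : ℂ) ^ 2 * (c x : ℂ) * u x) = ((-(k ^ 2 * c x) : ℝ) : ℂ) * u x := by
        push_cast; ring
      simp only [Function.comp_apply, Complex.reCLM_apply, Complex.imCLM_apply, e3,
        Complex.re_ofReal_mul, Complex.im_ofReal_mul]
      ring
    exact constant_of_has_deriv_right_zero
      (fun x hx => (hd x hx).continuousAt.continuousWithinAt)
      (fun x hx => (hd x (Ico_subset_Icc_self hx)).hasDerivWithinAt) 1 ⟨zero_le_one, le_rfl⟩
  -- no wave comes in from the left, and the source emits a wave of modulus one
  have hB : ∀ x < x₀, deriv u x - Complex.I * k * u x = 0 := by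
    intro x hx
    have h : ∀ y ≤ x, ‖deriv u y - Complex.I * k * u y‖ = ‖deriv u x - Complex.I * k * u x‖ := by
      intro y hy
      have := hu.norm_deriv_add_eq (κ := -k) (by ring) hy fun z hz =>
        ⟨(hz.2.trans_lt hx).ne, hc1 z fun h => by linarith [hz.2, h.1]⟩
      simp only [Complex.ofReal_neg, mul_neg, neg_mul, ← sub_eq_add_neg] at this
      exact this.symm
    have h2 := hu.radiation_left.norm
    rw [norm_zero] at h2
    have h3 : Tendsto (fun x : ℝ => ‖deriv u x - Complex.I * k * u x‖) atBot
        (𝓝 ‖deriv u x - Complex.I * k * u x‖) :=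
      tendsto_const_nhds.congr' (by
        filter_upwards [eventually_le_atBot x] with y hy using (h y hy).symm)
    exact norm_eq_zero.1 (tendsto_nhds_unique h3 h2)
  obtain ⟨a, b, ha, hb, hab⟩ := hu.jump
  have hul : Tendsto u (𝓝 x₀) (𝓝 (u x₀)) := hu.continuous.tendsto x₀
  have hb0 : b - Complex.I * k * u x₀ = 0 := by
    have h1 : Tendsto (fun x => deriv u x - Complex.I * k * u x) (𝓝[<] x₀)
        (𝓝 (b - Complex.I * k * u x₀)) :=
      hb.sub ((hul.mono_left nhdsWithin_le_nhds).const_mul _)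
    refine tendsto_nhds_unique h1 (tendsto_const_nhds.congr' ?_)
    filter_upwards [self_mem_nhdsWithin] with x hx using (hB x hx).symm
  -- The jump turns the value `0` on the left of the source into `-1` on its right; there is no
  -- scatterer between `x₀` and `0`.
  have hB0 : ‖deriv u 0 - Complex.I * k * u 0‖ = 1 := by
    have h1 : Tendsto (fun x => ‖deriv u x - Complex.I * k * u x‖) (𝓝[>] x₀)
        (𝓝 ‖a - Complex.I * k * u x₀‖) :=
      (ha.sub ((hul.mono_left nhdsWithin_le_nhds).const_mul _)).norm
    have h2 : a - Complex.I * k * u x₀ = -1 := by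
      rw [← hab]; linear_combination hb0
    rw [h2, norm_neg, norm_one] at h1
    refine tendsto_nhds_unique (tendsto_const_nhds.congr' ?_) h1
    filter_upwards [Ioo_mem_nhdsGT hx₀] with x hx
    have := hu.norm_deriv_add_eq (κ := -k) (by ring) hx.2.le fun z hz =>
      ⟨(hx.1.trans_le hz.1).ne', hc1 z fun h => by linarith [hz.2, h.1]⟩
    simpa only [Complex.ofReal_neg, mul_neg, neg_mul, ← sub_eq_add_neg] using this
  have hA0 : ‖deriv u 0 + Complex.I * k * u 0‖ ≤ 1 := by
    -- The conserved flux `Im(u' ū)` equals `-k|u(1)|²` at `1`, while at `0` it is `(|A|² -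
    -- |B|²)/(4k)`.
    have hflux : (deriv u 0).im * (u 0).re - (deriv u 0).re * (u 0).im ≤ 0 := by
      rw [← hW]
      have e : deriv u 1 = -(Complex.I * k * u 1) := by linear_combination hA1
      rw [e]
      simp only [Complex.neg_re, Complex.neg_im, Complex.mul_re, Complex.mul_im, Complex.I_re,
        Complex.I_im, Complex.ofReal_re, Complex.ofReal_im]
      nlinarith [mul_nonneg hk.le (sq_nonneg (u 1).re), mul_nonneg hk.le (sq_nonneg (u 1).im)]
    have hsq : ‖deriv u 0 + Complex.I * k * u 0‖ ^ 2 ≤ ‖deriv u 0 - Complex.I * k * u 0‖ ^ 2 := by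
      rw [Complex.sq_norm, Complex.sq_norm, Complex.normSq_apply, Complex.normSq_apply]
      simp only [Complex.add_re, Complex.add_im, Complex.sub_re, Complex.sub_im, Complex.mul_re,
        Complex.mul_im, Complex.I_re, Complex.I_im, Complex.ofReal_re, Complex.ofReal_im]
      nlinarith [mul_nonneg hk.le (neg_nonneg.2 hflux)]
    rw [← hB0]
    exact le_of_sq_le_sq hsq (norm_nonneg _)
  have h := norm_sub_le (deriv u 0 + Complex.I * k * u 0) (deriv u 0 - Complex.I * k * u 0)
  have e : deriv u 0 + Complex.I * k * u 0 - (deriv u 0 - Complex.I * k * u 0) =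
      2 * (Complex.I * k * u 0) := by ring
  rw [e, norm_mul, norm_mul, norm_mul, Complex.norm_I, Complex.norm_real,
    Real.norm_of_nonneg hk.le, Complex.norm_ofNat] at h
  linarith

end IsForwardSolution

lemma IsExact.norm_apply_zero_le {x₀ : ℝ} {c : ℝ → ℝ} {w ψ : ℝ → ℝ → ℂ} (h : IsExact x₀ c w ψ)
    (hx₀ : x₀ < 0) {k : ℝ} (hk : 0 < k) : ‖w 0 k‖ ≤ 2 := by
  obtain ⟨u, hu, hw⟩ := h.forward
  rw [hw 0 k hk, norm_div, u₀, norm_div]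
  have h1 : ‖Complex.exp (-(Complex.I * k * |0 - x₀|))‖ = 1 := by
    rw [show -(Complex.I * k * |0 - x₀|) = ((-(k * |0 - x₀|) : ℝ) : ℂ) * Complex.I by
      push_cast; ring]
    exact Complex.norm_exp_ofReal_mul_I _
  have h2 : ‖2 * Complex.I * (k : ℂ)‖ = 2 * k := by
    rw [norm_mul, norm_mul, Complex.norm_I, Complex.norm_real, Real.norm_of_nonneg hk.le,
      Complex.norm_ofNat, mul_one]
  rw [h1, h2, div_div_eq_mul_div, div_one]
  have := (hu k hk).norm_apply_zero_le h.coefficient hx₀ hk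
  linarith

/-! ### Bounds for the boundary data -/

section Boundary

variable {k₁ k₂ : ℝ} {g ℓ : ℝ → ℂ}

lemma hasDerivWithinAt_log (hℓ : ContDiffOn ℝ 1 ℓ (Icc k₁ k₂)) {k : ℝ} (hk : k ∈ Icc k₁ k₂) :
    HasDerivWithinAt ℓ (derivWithin ℓ (Icc k₁ k₂) k) (Icc k₁ k₂) k :=
  ((hℓ.differentiableOn one_ne_zero) k hk).hasDerivWithinAt

/-- Writing `1/g = e^{-ℓ}` reduces everything to the regularity of the logarithm. -/
lemma hasDerivWithinAt_p₁ (hk₁ : 0 < k₁) (hℓ : ContDiffOn ℝ 1 ℓ (Icc k₁ k₂))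
    (hg : ∀ k ∈ Icc k₁ k₂, Complex.exp (ℓ k) = g k) {k : ℝ} (hk : k ∈ Icc k₁ k₂) :
    HasDerivWithinAt (fun κ : ℝ => 2 * Complex.I / κ * (1 - 1 / g κ))
      (-(2 * Complex.I / k * (1 - 1 / g k)) / k +
        2 * Complex.I / k * (Complex.exp (-ℓ k) * derivWithin ℓ (Icc k₁ k₂) k)) (Icc k₁ k₂) k := by
  have hg' : ∀ κ ∈ Icc k₁ k₂, 2 * Complex.I / (κ : ℂ) * (1 - 1 / g κ) =
      2 * Complex.I * (κ : ℂ)⁻¹ * (1 - Complex.exp (-ℓ κ)) := by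
    intro κ hκ
    rw [← hg κ hκ, Complex.exp_neg, one_div, div_eq_mul_inv]
  have hk0 : (k : ℂ) ≠ 0 := by exact_mod_cast (hk₁.trans_le hk.1).ne'
  have h1 : HasDerivWithinAt (fun κ : ℝ => (κ : ℂ)) 1 (Icc k₁ k₂) k :=
    (hasDerivAt_id k).ofReal_comp.hasDerivWithinAt
  have h2 := ((h1.fun_inv hk0).const_mul (2 * Complex.I)).mul
    (((hasDerivWithinAt_log hℓ hk).neg.cexp).const_sub 1)
  refine (h2.congr hg' (hg' k hk)).congr_deriv ?_
  rw [hg' k hk]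
  simp only [Pi.neg_apply]
  field_simp

lemma p₁_eq (hk₁ : 0 < k₁) (hk₁₂ : k₁ < k₂) (hℓ : ContDiffOn ℝ 1 ℓ (Icc k₁ k₂))
    (hg : ∀ k ∈ Icc k₁ k₂, Complex.exp (ℓ k) = g k) {k : ℝ} (hk : k ∈ Icc k₁ k₂) :
    p₁ k₁ k₂ g k = -(2 * Complex.I / k * (1 - 1 / g k)) / k +
        2 * Complex.I / k * (Complex.exp (-ℓ k) * derivWithin ℓ (Icc k₁ k₂) k) :=
  (hasDerivWithinAt_p₁ hk₁ hℓ hg hk).derivWithin (uniqueDiffOn_Icc hk₁₂ k hk)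

lemma p₀_eq (hk₁ : 0 < k₁) (hk₁₂ : k₁ < k₂) (hℓ : ContDiffOn ℝ 1 ℓ (Icc k₁ k₂))
    {k : ℝ} (hk : k ∈ Icc k₁ k₂) :
    p₀ k₁ k₂ ℓ k = derivWithin ℓ (Icc k₁ k₂) k / (k : ℂ) ^ 2 - 2 * ℓ k / (k : ℂ) ^ 3 := by
  have hk0 : (k : ℂ) ≠ 0 := by exact_mod_cast (hk₁.trans_le hk.1).ne'
  have h1 : HasDerivWithinAt (fun κ : ℝ => (κ : ℂ)) 1 (Icc k₁ k₂) k :=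
    (hasDerivAt_id k).ofReal_comp.hasDerivWithinAt
  have h2 := (hasDerivWithinAt_log hℓ hk).fun_div (h1.fun_pow 2) (pow_ne_zero 2 hk0)
  refine (h2.derivWithin (uniqueDiffOn_Icc hk₁₂ k hk)).trans ?_
  push_cast
  field_simp

lemma continuousOn_derivWithin_log (hk₁₂ : k₁ < k₂) (hℓ : ContDiffOn ℝ 1 ℓ (Icc k₁ k₂)) :
    ContinuousOn (derivWithin ℓ (Icc k₁ k₂)) (Icc k₁ k₂) :=
  hℓ.continuousOn_derivWithin (uniqueDiffOn_Icc hk₁₂) le_rfl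

lemma continuousOn_inv_ofReal (hk₁ : 0 < k₁) :
    ContinuousOn (fun k : ℝ => (k : ℂ)⁻¹) (Icc k₁ k₂) :=
  ContinuousOn.inv₀ (by fun_prop) fun k hk => by exact_mod_cast (hk₁.trans_le hk.1).ne'

lemma continuousOn_p₀ (hk₁ : 0 < k₁) (hk₁₂ : k₁ < k₂) (hℓ : ContDiffOn ℝ 1 ℓ (Icc k₁ k₂)) :
    ContinuousOn (p₀ k₁ k₂ ℓ) (Icc k₁ k₂) := by
  have hi := continuousOn_inv_ofReal (k₂ := k₂) hk₁
  have h : ContinuousOn (fun k : ℝ => derivWithin ℓ (Icc k₁ k₂) k * ((k : ℂ)⁻¹) ^ 2 -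
      2 * ℓ k * ((k : ℂ)⁻¹) ^ 3) (Icc k₁ k₂) :=
    ((continuousOn_derivWithin_log hk₁₂ hℓ).mul (hi.pow 2)).sub
      ((continuousOn_const.mul hℓ.continuousOn).mul (hi.pow 3))
  refine h.congr fun k hk => ?_
  rw [p₀_eq hk₁ hk₁₂ hℓ hk]
  simp only [div_eq_mul_inv, inv_pow]

lemma continuousOn_p₁ (hk₁ : 0 < k₁) (hk₁₂ : k₁ < k₂) (hℓ : ContDiffOn ℝ 1 ℓ (Icc k₁ k₂))
    (hg : ∀ k ∈ Icc k₁ k₂, Complex.exp (ℓ k) = g k) :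
    ContinuousOn (p₁ k₁ k₂ g) (Icc k₁ k₂) := by
  have hi := continuousOn_inv_ofReal (k₂ := k₂) hk₁
  have he : ContinuousOn (fun k => Complex.exp (-ℓ k)) (Icc k₁ k₂) := hℓ.continuousOn.neg.cexp
  have h : ContinuousOn (fun k : ℝ => -(2 * Complex.I * (k : ℂ)⁻¹ * (1 - Complex.exp (-ℓ k))) *
      (k : ℂ)⁻¹ + 2 * Complex.I * (k : ℂ)⁻¹ *
        (Complex.exp (-ℓ k) * derivWithin ℓ (Icc k₁ k₂) k)) (Icc k₁ k₂) :=
    (((continuousOn_const.mul hi).mul (continuousOn_const.sub he)).neg.mul hi).add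
      ((continuousOn_const.mul hi).mul (he.mul (continuousOn_derivWithin_log hk₁₂ hℓ)))
  refine h.congr fun k hk => ?_
  rw [p₁_eq hk₁ hk₁₂ hℓ hg hk, ← hg k hk, one_div, ← Complex.exp_neg]
  simp only [div_eq_mul_inv]

/-- A bound for the logarithm of the data at `k₂`. -/
def logBound (k₂ r : ℝ) : ℝ := k₂ * r + 1

/-- A bound for the derivative of the logarithm of the data. -/
def logDerivBound (k₁ k₂ r M₁ : ℝ) : ℝ :=
  3 * (k₂ / 2) *
    (M₁ + (2 / k₂ * (1 + Real.exp (logBound k₂ r)) + M₁ * (k₂ - k₁)) / k₁)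

/-- A bound for `p₀` in terms of a bound for `p₁`. -/
def p₀Bound (k₁ k₂ r M₁ : ℝ) : ℝ :=
  logDerivBound k₁ k₂ r M₁ / k₁ ^ 2 +
    2 * (logBound k₂ r + logDerivBound k₁ k₂ r M₁ * (k₂ - k₁)) / k₁ ^ 3

lemma norm_one_sub_le (hg : Complex.exp (ℓ k₂) = g k₂) {B : ℝ} (hB : ‖ℓ k₂‖ ≤ B) :
    ‖1 - 1 / g k₂‖ ≤ 1 + Real.exp B := by
  rw [← hg, one_div, ← Complex.exp_neg]
  refine norm_sub_le_of_le norm_one.le ?_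
  rw [Complex.norm_exp]
  refine Real.exp_le_exp.2 (((Complex.re_le_norm _).trans ?_))
  rwa [norm_neg]

/-- The function `F = (2i/k)(1 - 1/g)` has derivative `p₁` and is controlled at `k₂`, hence on the
whole interval. The product rule, solved for `ℓ'`, gives `ℓ' = g (k/2i)(p₁ + F/k)`, where an upper
bound for `|g|` is indispensable. Integrating from `k₂` bounds `ℓ`, and `p₀` is a combination of `ℓ`
and `ℓ'`. -/
lemma norm_p₀_le (hk₁ : 0 < k₁) (hk₁₂ : k₁ < k₂) (hℓ : ContDiffOn ℝ 1 ℓ (Icc k₁ k₂))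
    (hg : ∀ k ∈ Icc k₁ k₂, Complex.exp (ℓ k) = g k) (hg3 : ∀ k ∈ Icc k₁ k₂, ‖g k‖ ≤ 3)
    {r M₁ : ℝ} (hr : ‖ℓ k₂‖ ≤ logBound k₂ r) (hM₁ : ∀ k ∈ Icc k₁ k₂, ‖p₁ k₁ k₂ g k‖ ≤ M₁)
    {k : ℝ} (hk : k ∈ Icc k₁ k₂) : ‖p₀ k₁ k₂ ℓ k‖ ≤ p₀Bound k₁ k₂ r M₁ := by
  have hk₂ : 0 < k₂ := hk₁.trans hk₁₂
  have hk₂m : k₂ ∈ Icc k₁ k₂ := ⟨hk₁₂.le, le_rfl⟩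
  have hM0 : 0 ≤ M₁ := (norm_nonneg _).trans (hM₁ k₂ hk₂m)
  have hl0 : 0 ≤ logBound k₂ r := (norm_nonneg _).trans hr
  set F : ℝ → ℂ := fun κ => 2 * Complex.I / κ * (1 - 1 / g κ) with hF
  set F₀ := 2 / k₂ * (1 + Real.exp (logBound k₂ r)) + M₁ * (k₂ - k₁) with hF₀
  have hFk₂ : ‖F k₂‖ ≤ 2 / k₂ * (1 + Real.exp (logBound k₂ r)) := by
    rw [hF, norm_mul, norm_div, norm_mul, Complex.norm_I, Complex.norm_real,
      Real.norm_of_nonneg hk₂.le, Complex.norm_ofNat, mul_one]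
    gcongr
    exact norm_one_sub_le (hg k₂ hk₂m) hr
  have hFk : ∀ κ ∈ Icc k₁ k₂, ‖F κ‖ ≤ F₀ := by
    intro κ hκ
    have h := (convex_Icc k₁ k₂).norm_image_sub_le_of_norm_derivWithin_le (f := F) (C := M₁)
      (fun x hx => (hasDerivWithinAt_p₁ hk₁ hℓ hg hx).differentiableWithinAt)
      (fun x hx => hM₁ x hx) hk₂m hκ
    have h2 : ‖κ - k₂‖ ≤ k₂ - k₁ := by
      rw [Real.norm_eq_abs, abs_le]; constructor <;> linarith [hκ.1, hκ.2]
    have h3 : M₁ * ‖κ - k₂‖ ≤ M₁ * (k₂ - k₁) := by gcongr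
    have h4 := norm_sub_norm_le (F κ) (F k₂)
    linarith
  have hF₀0 : 0 ≤ F₀ := (norm_nonneg _).trans (hFk k₂ hk₂m)
  set D := logDerivBound k₁ k₂ r M₁ with hD
  have hDe : D = 3 * (k₂ / 2) * (M₁ + F₀ / k₁) := rfl
  have hD0 : 0 ≤ D := by rw [hDe]; positivity
  have hder : ∀ κ ∈ Icc k₁ k₂, ‖derivWithin ℓ (Icc k₁ k₂) κ‖ ≤ D := by
    intro κ hκ
    have hκ0 : 0 < κ := hk₁.trans_le hκ.1
    have hκ' : (κ : ℂ) ≠ 0 := by exact_mod_cast hκ0.ne'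
    have e : derivWithin ℓ (Icc k₁ k₂) κ =
        g κ * (κ / (2 * Complex.I)) * (p₁ k₁ k₂ g κ + F κ / κ) := by
      rw [p₁_eq hk₁ hk₁₂ hℓ hg hκ, hF, Complex.exp_neg, hg κ hκ]
      have hg0 : g κ ≠ 0 := by rw [← hg κ hκ]; exact Complex.exp_ne_zero _
      field_simp
      ring
    rw [e, hDe, norm_mul, norm_mul, norm_div, norm_mul, Complex.norm_I, Complex.norm_real,
      Real.norm_of_nonneg hκ0.le, Complex.norm_ofNat, mul_one]
    have h1 : ‖p₁ k₁ k₂ g κ + F κ / κ‖ ≤ M₁ + F₀ / k₁ := by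
      refine norm_add_le_of_le (hM₁ κ hκ) ?_
      rw [norm_div, Complex.norm_real, Real.norm_of_nonneg hκ0.le]
      exact div_le_div₀ hF₀0 (hFk κ hκ) hk₁ hκ.1
    have h2 := hg3 κ hκ
    have h3 := hκ.2
    gcongr
  have hlog : ‖ℓ k‖ ≤ logBound k₂ r + D * (k₂ - k₁) := by
    have h := (convex_Icc k₁ k₂).norm_image_sub_le_of_norm_derivWithin_le (f := ℓ) (C := D)
      (hℓ.differentiableOn one_ne_zero) hder hk₂m hk
    have h2 : ‖k - k₂‖ ≤ k₂ - k₁ := by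
      rw [Real.norm_eq_abs, abs_le]; constructor <;> linarith [hk.1, hk.2]
    have h3 : D * ‖k - k₂‖ ≤ D * (k₂ - k₁) := by gcongr
    have h4 := norm_sub_norm_le (ℓ k) (ℓ k₂)
    linarith
  have hk0 : 0 < k := hk₁.trans_le hk.1
  rw [p₀_eq hk₁ hk₁₂ hℓ hk, p₀Bound]
  refine norm_sub_le_of_le ?_ ?_
  · rw [norm_div, norm_pow, Complex.norm_real, Real.norm_of_nonneg hk0.le]
    exact div_le_div₀ hD0 (hder k hk) (by positivity) (pow_le_pow_left₀ hk₁.le hk.1 2)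
  · rw [norm_div, norm_pow, norm_mul, Complex.norm_ofNat, Complex.norm_real,
      Real.norm_of_nonneg hk0.le]
    exact div_le_div₀ (by nlinarith [mul_nonneg hD0 (sub_nonneg.2 hk₁₂.le)])
      (by linarith) (by positivity) (pow_le_pow_left₀ hk₁.le hk.1 3)

end Boundary

/-! ### The tail function -/

lemma IsPrimitive.continuousOn {F f : ℝ → ℂ} (h : IsPrimitive F f) :
    ContinuousOn F (Icc 0 1) := by
  have h1 := intervalIntegral.continuousOn_primitive_interval (μ := volume) (f := f) (a := 0)
    (b := 1) (by
      rw [uIcc_of_le zero_le_one]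
      exact (intervalIntegrable_iff_integrableOn_Icc_of_le zero_le_one).1 h.1)
  rw [uIcc_of_le zero_le_one] at h1
  exact (continuousOn_const.add h1).congr h.2

/-- The quadratic polynomial `a + b (x - x²/2)` as an element of `H³(0,1)`. -/
def quadraticH3 (a b : ℂ) : H3Fun where
  val x := a + b * (x - (x : ℂ) ^ 2 / 2)
  d1 x := b * (1 - x)
  d2 _ := -b
  d3 _ := 0
  prim1 := by
    refine ⟨Continuous.intervalIntegrable (by fun_prop) _ _, fun x _ => ?_⟩
    have hd : ∀ y ∈ uIcc 0 x, HasDerivAt (fun y : ℝ => a + b * (y - (y : ℂ) ^ 2 / 2))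
        (b * (1 - y)) y := by
      intro y _
      have hy : HasDerivAt (fun y : ℝ => (y : ℂ)) 1 y := (hasDerivAt_id y).ofReal_comp
      refine (((hy.sub ((hy.fun_pow 2).div_const 2)).const_mul b).const_add a).congr_deriv ?_
      push_cast
      ring
    rw [intervalIntegral.integral_eq_sub_of_hasDerivAt hd
      (Continuous.intervalIntegrable (by fun_prop) _ _)]
    ring
  prim2 := by
    refine ⟨intervalIntegrable_const (μ := volume), fun x _ => ?_⟩
    simp
    ring
  prim3 := ⟨intervalIntegrable_const (μ := volume), fun x _ => by simp⟩
  memLp := MemLp.zero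

lemma qrm_quadraticH3_le (a b : ℂ) {α : ℝ} (hα1 : α ≤ 1) :
    qrm α (quadraticH3 a b) ≤ 2 * (‖a‖ + ‖b‖) ^ 2 := by
  have h1 : (∫ x in (0 : ℝ)..1, ‖(quadraticH3 a b).d2 x‖ ^ 2) = ‖b‖ ^ 2 := by
    simp [quadraticH3]
  have h2 : (quadraticH3 a b).normSq ≤ 3 * (‖a‖ + ‖b‖) ^ 2 := by
    have hc : Continuous fun x => ‖(quadraticH3 a b).val x‖ ^ 2 + ‖(quadraticH3 a b).d1 x‖ ^ 2 +
        ‖(quadraticH3 a b).d2 x‖ ^ 2 + ‖(quadraticH3 a b).d3 x‖ ^ 2 := by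
      simp only [quadraticH3]
      fun_prop
    have h := intervalIntegral.integral_mono_on (zero_le_one : (0 : ℝ) ≤ 1)
      (hc.intervalIntegrable 0 1) (intervalIntegrable_const (μ := volume) (c := 3 * (‖a‖ + ‖b‖) ^ 2))
      (fun x hx => by
        have a0 := norm_nonneg a
        have b0 := norm_nonneg b
        have e1 : ‖(quadraticH3 a b).val x‖ ≤ ‖a‖ + ‖b‖ := by
          refine norm_add_le_of_le le_rfl ?_
          rw [norm_mul, show (x : ℂ) - (x : ℂ) ^ 2 / 2 = ((x - x ^ 2 / 2 : ℝ) : ℂ) by push_cast; ring,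
            Complex.norm_real, Real.norm_eq_abs]
          refine mul_le_of_le_one_right b0 (abs_le.2 ⟨?_, ?_⟩) <;> nlinarith [hx.1, hx.2]
        have e2 : ‖(quadraticH3 a b).d1 x‖ ≤ ‖b‖ := by
          show ‖b * (1 - (x : ℂ))‖ ≤ ‖b‖
          rw [norm_mul, show 1 - (x : ℂ) = ((1 - x : ℝ) : ℂ) by push_cast; ring,
            Complex.norm_real, Real.norm_eq_abs]
          refine mul_le_of_le_one_right b0 (abs_le.2 ⟨?_, ?_⟩) <;> linarith [hx.1, hx.2]
        have e3 : ‖(quadraticH3 a b).d2 x‖ = ‖b‖ := norm_neg b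
        have e4 : ‖(quadraticH3 a b).d3 x‖ = 0 := norm_zero
        rw [e3, e4]
        have f1 := pow_le_pow_left₀ (norm_nonneg _) e1 2
        have f2 := pow_le_pow_left₀ (norm_nonneg _) e2 2
        nlinarith)
    simpa [H3Fun.normSq] using h
  have h3 : 0 ≤ (quadraticH3 a b).normSq :=
    intervalIntegral.integral_nonneg zero_le_one fun _ _ => by positivity
  rw [qrm, h1]
  have a0 := norm_nonneg a
  have b0 := norm_nonneg b
  nlinarith [mul_le_of_le_one_left h3 hα1, mul_nonneg a0 b0]

/-- The derivative of the tail function is bounded in terms of its boundary values. -/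
lemma IsTailMinimizer.norm_d1_le {k₂ α : ℝ} {g ℓ : ℝ → ℂ} {V : H3Fun}
    (hV : IsTailMinimizer k₂ α g ℓ V) (hα : 0 ≤ α) (hα1 : α ≤ 1) {x : ℝ}
    (hx : x ∈ Icc (0 : ℝ) 1) :
    ‖V.d1 x‖ ≤ 3 * (‖ℓ k₂ / (k₂ : ℂ) ^ 2‖ + ‖Complex.I / k₂ * (1 - 1 / g k₂)‖) := by
  obtain ⟨⟨-, hb, -⟩, hmin⟩ := hV
  set a := ℓ k₂ / (k₂ : ℂ) ^ 2
  set b := Complex.I / k₂ * (1 - 1 / g k₂)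
  -- The competitor has derivative `b(1 - x)`, so it meets both conditions on the derivative. Its
  -- functional is at most `2(‖a‖ + ‖b‖)²` because `α ≤ 1`, which makes the bound uniform in the
  -- noise level.
  have h1 := hmin (quadraticH3 a b) ⟨by simp [quadraticH3, a], by simp [quadraticH3, b],
    by simp [quadraticH3]⟩
  have h2 : 0 ≤ V.normSq := intervalIntegral.integral_nonneg zero_le_one fun _ _ => by positivity
  have h3 : (∫ y in (0 : ℝ)..1, ‖V.d2 y‖ ^ 2) ≤ (2 * (‖a‖ + ‖b‖)) ^ 2 := by
    have := h1.trans (qrm_quadraticH3_le a b hα1)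
    rw [qrm] at this
    nlinarith [mul_nonneg hα h2]
  have hc := V.prim3.continuousOn
  have hm : MemLp V.d2 2 μ01 := by
    obtain ⟨C, hC⟩ := isCompact_Icc.exists_bound_of_continuousOn hc
    refine MemLp.of_bound ((hc.mono Ioo_subset_Icc_self).aestronglyMeasurable measurableSet_Ioo)
      C ?_
    filter_upwards [ae_restrict_mem measurableSet_Ioo] with y hy
    exact hC y (Ioo_subset_Icc_self hy)
  have h4 : ∫ y in (0 : ℝ)..1, ‖V.d2 y‖ ≤ 2 * (‖a‖ + ‖b‖) := by
    have h := sq_integral_mul_le (μ := μ01) (f := fun _ => 1) (g := fun y => ‖V.d2 y‖)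
      (memLp_const _) hm.norm (fun _ => zero_le_one) fun _ => norm_nonneg _
    rw [intervalIntegral.integral_of_le zero_le_one, integral_Ioc_eq_integral_Ioo] at h3 ⊢
    simp only [one_mul] at h
    refine h.trans ?_
    have e : √(∫ _ : ℝ, (1 : ℝ) ^ 2 ∂μ01) = 1 := by simp
    rw [e, one_mul]
    exact Real.sqrt_le_iff.2 ⟨by positivity, h3⟩
  rw [V.prim2.2 x hx, hb]
  have h5 : ‖∫ s in (0 : ℝ)..x, V.d2 s‖ ≤ ∫ y in (0 : ℝ)..1, ‖V.d2 y‖ :=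
    (intervalIntegral.norm_integral_le_integral_norm hx.1).trans
      (intervalIntegral.integral_mono_interval le_rfl hx.1 hx.2
        (Eventually.of_forall fun s => norm_nonneg _) V.prim2.1.norm)
  refine (norm_add_le_of_le le_rfl (h5.trans h4)).trans ?_
  linarith [norm_nonneg a, norm_nonneg b]

/-- A bound for the derivative of the tail function. -/
def tailBound (k₂ r : ℝ) : ℝ :=
  3 * (logBound k₂ r / k₂ ^ 2 + (1 + Real.exp (logBound k₂ r)) / k₂)

lemma IsTailMinimizer.norm_d1_le_tailBound {k₂ α r : ℝ} {g ℓ : ℝ → ℂ} {V : H3Fun}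
    (hV : IsTailMinimizer k₂ α g ℓ V) (hα : 0 ≤ α) (hα1 : α ≤ 1) (hk₂ : 0 < k₂)
    (hg : Complex.exp (ℓ k₂) = g k₂) (hr : ‖ℓ k₂‖ ≤ logBound k₂ r) {x : ℝ}
    (hx : x ∈ Icc (0 : ℝ) 1) : ‖V.d1 x‖ ≤ tailBound k₂ r := by
  refine (hV.norm_d1_le hα hα1 hx).trans ?_
  rw [norm_div, norm_mul, norm_div, norm_pow, Complex.norm_I, Complex.norm_real,
    Real.norm_of_nonneg hk₂.le, tailBound, div_mul_eq_mul_div, one_mul]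
  have := norm_one_sub_le hg hr
  gcongr

/-- The exact logarithm at `k₂` is `k₂ r(0)`. This is the only place where `r*` enters the
estimates. -/
lemma IsNoisyData.norm_log_le {k₁ k₂ δ : ℝ} {w ψ : ℝ → ℝ → ℂ} {g ℓ r : ℝ → ℂ}
    (h : IsNoisyData k₁ k₂ δ w ψ g ℓ) (hδ : δ ≤ 1) (hk₂ : 0 < k₂) (hk : k₁ ≤ k₂)
    (hr : ψ 0 k₂ / (k₂ : ℂ) ^ 2 = r 0 / k₂) : ‖ℓ k₂‖ ≤ logBound k₂ ‖r 0‖ := by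
  have hk0 : (k₂ : ℂ) ≠ 0 := by exact_mod_cast hk₂.ne'
  have e : ψ 0 k₂ = k₂ * r 0 := by
    field_simp at hr
    exact hr
  have h1 := h.log_le k₂ ⟨hk, le_rfl⟩
  have h2 := norm_sub_norm_le (ℓ k₂) (ψ 0 k₂)
  have h3 : ‖ψ 0 k₂‖ = k₂ * ‖r 0‖ := by
    rw [e, norm_mul, Complex.norm_real, Real.norm_of_nonneg hk₂.le]
  rw [logBound]
  linarith

lemma IsNoisyData.norm_le_three {x₀ k₁ k₂ δ : ℝ} {c : ℝ → ℝ} {w ψ : ℝ → ℝ → ℂ} {g ℓ : ℝ → ℂ}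
    (h : IsNoisyData k₁ k₂ δ w ψ g ℓ) (hw : IsExact x₀ c w ψ) (hx₀ : x₀ < 0) (hδ : δ ≤ 1)
    (hk₁ : 0 < k₁) {k : ℝ} (hk : k ∈ Icc k₁ k₂) : ‖g k‖ ≤ 3 := by
  have h1 := h.le k hk
  have h2 := norm_sub_norm_le (g k) (w 0 k)
  have h3 := hw.norm_apply_zero_le hx₀ (hk₁.trans_le hk.1)
  linarith

/-! ### Choice of the constants and the main theorem. -/

lemma seven_div_six_le_lipConst (C : ℝ) {R : ℝ} (hR : 0 < R) (ε : ℝ) : 7 / 6 ≤ lipConst C R ε := by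
  have hC : 0 ≤ C ^ 4 := by positivity
  have : 0 ≤ 2 * ε ^ 2 * ((7 * C ^ 4 + 7 * C ^ 4 * (2 * R)) * (7 * C ^ 4 + 7 * C ^ 4 * (2 * R)) +
      (7 * C ^ 4 + 7 * C ^ 4 * R + 7 * C ^ 4 * R * R) * (2 * (7 * C ^ 4))) := by positivity
  rw [lipConst]
  linarith

/-- Positivity comes from `Λ ≥ 1`, since `1 - γ/3 + γ² > 0`; the upper bound is the restriction on
`γ`. -/
lemma contraction_factor_mem {Λ γ : ℝ} (hΛ : 7 / 6 ≤ Λ)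
    (hγ : γ ∈ Ioo 0 (4 * (1 / 12) / Λ ^ 2)) :
    √(1 - 4 * (1 / 12) * γ + Λ ^ 2 * γ ^ 2) ∈ Ioo (0 : ℝ) 1 := by
  have h1 : γ * Λ ^ 2 < 4 * (1 / 12) := (lt_div_iff₀ (by positivity)).1 hγ.2
  have h0 := hγ.1
  constructor
  · rw [Real.sqrt_pos]
    have : 1 ≤ Λ ^ 2 := by nlinarith
    nlinarith [sq_nonneg (1 - γ), sq_nonneg γ, mul_nonneg (sub_nonneg.2 this) (sq_nonneg γ)]
  · rw [Real.sqrt_lt' one_pos]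
    nlinarith

/-- The Carleman parameter is large enough to absorb lower order terms of size `A`. -/
lemma mul_sqrt_inv_le_one {A lam : ℝ} (h0 : 0 < lam) (h : A ^ 2 ≤ lam) :
    A * √(1 / (2 * lam)) ≤ 1 := by
  refine le_of_abs_le (abs_le_one_iff_mul_self_le_one.2 ?_)
  rw [mul_mul_mul_comm, Real.mul_self_sqrt (by positivity), mul_one_div, div_le_one (by positivity)]
  nlinarith

end HelmholtzCIP

end

open HelmholtzCIP

theorem theorem5p3 (x₀ : ℝ) (hx₀ : x₀ < 0) (k₁ k₂ : ℝ) (hk₁ : 0 < k₁) (hk : k₁ < k₂)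
    (r : ℝ → ℂ) :
    ∃ δ₀ : ℝ, 0 < δ₀ ∧
    ∀ (R : ℝ) (hR : 0 < R) (M₁ : ℝ),
    ∃ lam₀ : ℝ, 1 < lam₀ ∧
    ∀ lam : ℝ, lam₀ ≤ lam → ∀ M₀ : ℝ,
    ∃ γ₀ ∈ Ioo (0 : ℝ) 1, ∃ q : ℝ → ℝ, (∀ γ ∈ Ioo 0 γ₀, q γ ∈ Ioo (0 : ℝ) 1) ∧
    ∀ (c : ℝ → ℝ) (w ψ : ℝ → ℝ → ℂ), IsExact x₀ c w ψ →
    (∀ x ∈ Icc (0 : ℝ) 1, ψ x k₂ / (k₂ : ℂ) ^ 2 = r x / k₂) →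
    ∀ (δ : ℝ), 0 < δ → δ ≤ δ₀ →
    ∀ (g ℓ : ℝ → ℂ), IsNoisyData k₁ k₂ δ w ψ g ℓ →
    ∀ V : H3Fun, IsTailMinimizer k₂ (δ ^ 2) g ℓ V →
    (∀ k ∈ Icc k₁ k₂, ‖p₀ k₁ k₂ ℓ k‖ ≤ M₀) → (∀ k ∈ Icc k₁ k₂, ‖p₁ k₁ k₂ g k‖ ≤ M₁) →
    let J : HSpace k₁ k₂ → ℝ := cost (p₀ k₁ k₂ ℓ) (p₁ k₁ k₂ g) V.d1 lam
    (∀ p, DifferentiableAt ℝ J p) ∧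
    ∃ pmin ∈ cball (HSpace k₁ k₂) R,
      IsMinOn J (cball (HSpace k₁ k₂) R) pmin ∧
      (∀ p ∈ cball (HSpace k₁ k₂) R, IsMinOn J (cball (HSpace k₁ k₂) R) p → p = pmin) ∧
      ∀ γ ∈ Ioo 0 γ₀, ∀ p ∈ cball (HSpace k₁ k₂) R,
        Tendsto (gradProj hR J γ p) atTop (𝓝 pmin) ∧
        ∀ n : ℕ, ‖gradProj hR J γ p n - pmin‖ ≤ q γ ^ n * ‖p - pmin‖ := by
  set r₀ := ‖r 0‖
  refine ⟨1, one_pos, fun R hR M₁ => ?_⟩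
  -- The bound for `p₀` used here is derived from `r₀` and `M₁`, since `C` determines the threshold
  -- for `λ` and must be fixed before `M₀`.
  set C := coeffBound k₁ k₂ (p₀Bound k₁ k₂ r₀ M₁) M₁ (tailBound k₂ r₀)
  refine ⟨max 2 ((24 * C ^ 4 * (1 + R)) ^ 2), one_lt_two.trans_le (le_max_left _ _),
    fun lam hlam M₀ => ?_⟩
  have hlam0 : 0 < lam := two_pos.trans_le ((le_max_left _ _).trans hlam)
  set Λ := lipConst C R (Real.exp lam)
  have hΛ : 7 / 6 ≤ Λ := seven_div_six_le_lipConst C hR _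
  have hΛ0 : 0 < Λ := by linarith
  -- The second entry is the step size limit `4κ/Λ²` with `κ = 1/12`; the first keeps `γ₀` below
  -- `1`.
  refine ⟨min (1 / 2) (4 * (1 / 12) / Λ ^ 2), ⟨lt_min (by norm_num) (by positivity),
    (min_le_left _ _).trans_lt (by norm_num)⟩,
    fun γ => √(1 - 4 * (1 / 12) * γ + Λ ^ 2 * γ ^ 2),
    fun γ hγ => contraction_factor_mem hΛ ⟨hγ.1, hγ.2.trans_le (min_le_right _ _)⟩, ?_⟩
  intro c w ψ hw hr δ hδ0 hδ g ℓ hg V hV _ hM₁ J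
  have hk₂ : 0 < k₂ := hk₁.trans hk
  have hℓ : ‖ℓ k₂‖ ≤ logBound k₂ r₀ := hg.norm_log_le hδ hk₂ hk.le (hr 0 zero_mem_Icc01)
  have h₀ := continuousOn_p₀ hk₁ hk hg.contDiffOn
  have h₁ := continuousOn_p₁ hk₁ hk hg.contDiffOn hg.exp_eq
  have hd := V.prim2.continuousOn
  have hK := boundedBy_coeffs hk₁ hk h₀ h₁ hd
    (fun k hk' => norm_p₀_le hk₁ hk hg.contDiffOn hg.exp_eq
      (fun κ hκ => hg.norm_le_three hw hx₀ hδ hk₁ hκ) hℓ hM₁ hk')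
    hM₁ (fun x hx => hV.norm_d1_le_tailBound (sq_nonneg δ) (pow_le_one₀ hδ0.le hδ) hk₂
      (hg.exp_eq k₂ ⟨hk.le, le_rfl⟩) hℓ hx)
  have hJ := cost_eq hk hlam0 h₀ h₁ hd
  refine ⟨fun p => ?_, ?_⟩
  · show DifferentiableAt ℝ (cost (p₀ k₁ k₂ ℓ) (p₁ k₁ k₂ g) V.d1 lam) p
    rw [hJ]
    exact (model hk hlam0).differentiableAt_cost hK p
  · obtain ⟨pmin, hp, hmin, huniq, hconv⟩ := (model hk hlam0).gradProj_converges hK hR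
      (Real.sqrt_nonneg _) (Real.exp_pos lam)
      (mul_sqrt_inv_le_one hlam0 ((le_max_right _ _).trans hlam)) hJ
    exact ⟨pmin, hp, hmin, huniq, fun γ hγ =>
      hconv γ ⟨hγ.1, hγ.2.trans_le (min_le_right _ _)⟩⟩
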